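/- Let $V:\mathbb R\to\mathbb R$ be $C^2$ and $c\in\mathbb R$ with $c^2\neq1$. Let $u=f(x-ct)$ be a periodic traveling wave of the Klein--Gordon equation $u_{tt}-u_{xx}+V'(u)=0$; that is, $f:\mathbb R\to\mathbb R$ satisfies $(c^2-1)f''+V'(f)=0$ and $f'$ is periodic with fundamental period $T>0$. For $\lambda\in\mathbb C$ consider the linearized equation $$(c^2-1)w''-2c\lambda w'+(\lambda^2+V''(f(z)))w=0. \qquad (1)$$ Let $\sigma$ be the set of $\lambda\in\mathbb C$ for which (1) has a nontrivial bounded solution $w:\mathbb R\to\mathbb C$. Let $w_1,w_2$ be the solutions of (1) with $w_1(0)=w_2'(0)=1$, $w_1'(0)=w_2(0)=0$, let $\mathbf M(\lambda)=\begin{bmatrix}w_1(T)&w_2(T)\\w_1'(T)&w_2'(T)\end{bmatrix}$ and $D(\lambda,\mu)=\det(\mathbf M(\lambda)-\mu\mathbb I)$. For $\nu\in\mathbb C$ consider Hill's equation $y''+P(z)y=\nu y$ with $P(z)=V''(f(z))/(c^2-1)$, let $\mathbf M^{\mathrm H}(\nu)$ be its monodromy matrix over $[0,T]$, defined in the same way,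 and let $\Delta^{\mathrm H}(\nu)=\operatorname{tr}\mathbf M^{\mathrm H}(\nu)$. The Hill spectrum $\Sigma^{\mathrm H}$ is the set of $\nu$ for which $\mathbf M^{\mathrm H}(\nu)$ has an eigenvalue of modulus $1$; its gaps are the intervals that make up $\mathbb R\setminus\Sigma^{\mathrm H}$. Put $\gamma_{\mathrm M}=\operatorname{sgn}\Delta^{\mathrm H}_\nu(0)$ and $\gamma_{\mathrm P}=\operatorname{sgn}\big((c^2-1)D_{\lambda\lambda}(0,1)\big)$, where subscripts $\nu,\lambda$ denote derivatives. Suppose that $\Delta^{\mathrm H}_\nu(0)\neq c^2T^2$ and $\gamma_{\mathrm M}\gamma_{\mathrm P}=1$. If $c^2>1$ and some $\nu<0$ lies in a gap of $\Sigma^{\mathrm H}$, then the wave exhibits a dynamical Hamiltonian--Hopf instability: there is a nonzero $\lambda\in i\mathbb R$ every neighborhood of which contains a point of $\sigma\setminus i\mathbb R$. -/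

import Mathlib

open scoped Topology

namespace KleinGordon

/-- `u(x,t) = f(x - ct)` is a periodic traveling wave of `u_tt - u_xx + V'(u) = 0` with velocity `c`:
the profile solves `(c² - 1) f'' + V'(f) = 0` and `f'` is periodic with fundamental period `T`. -/
structure IsPeriodicTravelingWave (V : ℝ → ℝ) (c T : ℝ) (f : ℝ → ℝ) : Prop where
  contDiff : ContDiff ℝ 2 f
  ode : ∀ z : ℝ, (c ^ 2 - 1) * deriv (deriv f) z + deriv V (f z) = 0
  fundamental_period : IsLeast {S : ℝ | 0 < S ∧ Function.Periodic (deriv f) S} T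

/-- `w` solves `(c² - 1) w'' - 2 c lam w' + (lam² + V''(f(z))) w = 0` on the whole line. -/
def IsLinearizedSol (V : ℝ → ℝ) (c : ℝ) (f : ℝ → ℝ) (lam : ℂ) (w : ℝ → ℂ) : Prop :=
  ContDiff ℝ 2 w ∧ ∀ z : ℝ,
    ((c : ℂ) ^ 2 - 1) * deriv (deriv w) z - 2 * (c : ℂ) * lam * deriv w z
      + (lam ^ 2 + ((deriv (deriv V) (f z) : ℝ) : ℂ)) * w z = 0

/-- The Floquet spectrum `σ`: those `lam` for which the linearized equation has a nontrivial
bounded solution. -/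
def floquetSpectrum (V : ℝ → ℝ) (c : ℝ) (f : ℝ → ℝ) : Set ℂ :=
  {lam | ∃ w : ℝ → ℂ, IsLinearizedSol V c f lam w ∧ w ≠ 0 ∧ ∃ K : ℝ, ∀ z : ℝ, ‖w z‖ ≤ K}

/-- The solution `w` of the linearized equation with `w(0) = a`, `w'(0) = b`
(it exists and is unique, because the equation is linear with continuous coefficients). -/
noncomputable def linearizedSol (V : ℝ → ℝ) (c : ℝ) (f : ℝ → ℝ) (lam a b : ℂ) : ℝ → ℂ :=
  Classical.epsilon fun w => IsLinearizedSol V c f lam w ∧ w 0 = a ∧ deriv w 0 = b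

/-- The monodromy matrix `M(lam)` of the linearized equation. -/
noncomputable def monodromy (V : ℝ → ℝ) (c T : ℝ) (f : ℝ → ℝ) (lam : ℂ) :
    Matrix (Fin 2) (Fin 2) ℂ :=
  !![linearizedSol V c f lam 1 0 T, linearizedSol V c f lam 0 1 T;
     deriv (linearizedSol V c f lam 1 0) T, deriv (linearizedSol V c f lam 0 1) T]

/-- `D(lam, μ) = det (M(lam) - μ I)`; for `μ = 1` it is the periodic Evans function. -/
noncomputable def evans (V : ℝ → ℝ) (c T : ℝ) (f : ℝ → ℝ) (lam μ : ℂ) : ℂ :=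
  (monodromy V c T f lam - μ • (1 : Matrix (Fin 2) (Fin 2) ℂ)).det

/-- The potential `P(z) = V''(f(z)) / (c² - 1)` in Hill's equation. -/
noncomputable def hillPotential (V : ℝ → ℝ) (c : ℝ) (f : ℝ → ℝ) (z : ℝ) : ℝ :=
  deriv (deriv V) (f z) / (c ^ 2 - 1)

/-- `y` solves Hill's equation `y'' + P(z) y = ν y` on the whole line. -/
def IsHillSol (P : ℝ → ℝ) (ν : ℂ) (y : ℝ → ℂ) : Prop :=
  ContDiff ℝ 2 y ∧ ∀ z : ℝ, deriv (deriv y) z + (P z : ℂ) * y z = ν * y z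

/-- The solution `y` of Hill's equation with `y(0) = a`, `y'(0) = b`
(it exists and is unique when `P` is continuous). -/
noncomputable def hillSol (P : ℝ → ℝ) (ν a b : ℂ) : ℝ → ℂ :=
  Classical.epsilon fun y => IsHillSol P ν y ∧ y 0 = a ∧ deriv y 0 = b

/-- The monodromy matrix of Hill's equation over one period `T`. -/
noncomputable def hillMonodromy (P : ℝ → ℝ) (T : ℝ) (ν : ℂ) : Matrix (Fin 2) (Fin 2) ℂ :=
  !![hillSol P ν 1 0 T, hillSol P ν 0 1 T;
     deriv (hillSol P ν 1 0) T, deriv (hillSol P ν 0 1) T]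

/-- The Hill discriminant. -/
noncomputable def hillDiscriminant (P : ℝ → ℝ) (T : ℝ) (ν : ℂ) : ℂ :=
  (hillMonodromy P T ν).trace

/-- The Hill spectrum: those `ν` for which some Hill Floquet multiplier (an eigenvalue of the
monodromy matrix) has unit modulus. -/
def hillSpectrum (P : ℝ → ℝ) (T : ℝ) : Set ℂ :=
  {ν | ∃ μ ∈ spectrum ℂ (hillMonodromy P T ν), ‖μ‖ = 1}

/-- Some negative real number lies in a gap of the Hill spectrum, the gaps being the intervals
that make up the complement of the spectrum in the real line. -/
def HasNegativeGap (P : ℝ → ℝ) (T : ℝ) : Prop :=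
  ∃ ν : ℝ, ν < 0 ∧ (ν : ℂ) ∉ hillSpectrum P T

/-- The modulational instability index: the sign of the derivative at `ν = 0` of the Hill
discriminant (which is real on the real line). -/
noncomputable def modulationalIndex (V : ℝ → ℝ) (c T : ℝ) (f : ℝ → ℝ) : SignType :=
  SignType.sign (deriv (hillDiscriminant (hillPotential V c f) T) 0).re

/-- The parity index: the sign of `(c² - 1) D_{lam lam}(0, 1)`
(the periodic Evans function is real on the real line). -/
noncomputable def parityIndex (V : ℝ → ℝ) (c T : ℝ) (f : ℝ → ℝ) : SignType :=
  SignType.sign ((c ^ 2 - 1) * (iteratedDeriv 2 (fun lam : ℂ => evans V c T f lam 1) 0).re)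

/-- The wave exhibits a dynamical Hamiltonian–Hopf instability at `lam`, a nonzero imaginary number:
every neighborhood of `lam` contains points of `σ` off the imaginary axis. -/
def HasDynamicalHHInstabilityAt (V : ℝ → ℝ) (c : ℝ) (f : ℝ → ℝ) (lam : ℂ) : Prop :=
  lam ≠ 0 ∧ lam.re = 0 ∧
    ∀ U ∈ 𝓝 lam, ((floquetSpectrum V c f ∩ U) \ {z : ℂ | z.re = 0}).Nonempty

end KleinGordon

/-! The substitution `w = exp (c λ z / (c² - 1)) y` turns (1) into Hill's equation with `ν = (λ /
(c² - 1))²`. Write `λ = (c² - 1) i z`, `g z = Δ(-z²)` and `k = c T`, where `Δ` is the Hill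
discriminant. If `2 cos (k z - θ) = g z` for some real `θ`, then a multiplier of (1) is unimodular
and `λ ∈ σ`. Imaginary `λ` correspond to real `z`, so it suffices to find nonreal `z` satisfying
this dispersion relation arbitrarily close to a nonzero real point.

On a real interval where `g² ≤ 4`, the Hill multipliers are `E, F = (g ± i √(4 - g²)) / 2`. They are
unimodular there, and they are holomorphic because the nonnegative function `4 - g²` has only zeros
of even order inside the interval. The relation says that `exp (i k z) F` or `exp (i k z) E` has
modulus 1. Where such a function has a critical point on the real axis, the level curve of modulus 1
branches off the axis. The critical points are those where the phase velocity of the multipliers is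
`± k`, that is, where `g'² / (4 - g²)` has the limit `k²`.

Such a point exists. Since `f'` is a `T`-periodic solution of Hill's equation at `ν = 0`, `Δ(0) =
2`. The index condition says `0 < Δ'(0) < k²`, which makes `G = k² (4 - g²) - g'²` positive just to
the right of 0. The gap at negative `ν` supplies a first band edge `b > 0`, with `G(b) = -g'(b)²`.
If `g'(b) ≠ 0`, `G` becomes negative before `b`, and its first passage gives the point. If `g'(b) =
0`, the edge itself serves, after the branch point is uniformized by `z = b - ζ²`.

The lemmas that carry this are `exists_nonreal_norm_eq_one`, `exists_nonreal_dispersion` and the two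
band-edge theorems; `deriv_hillDiscriminant_mem` and `mem_floquetSpectrum` connect them to the wave.
-/

/-! ### Linear differential equations: existence and uniqueness -/

section LinearODE

variable {E : Type*} [NormedAddCommGroup E] [NormedSpace ℝ E]

/-- Picard iterates for the linear equation `Y' = A(t) Y`, `Y 0 = v`. -/
noncomputable def picardTerm (A : ℝ → E →L[ℝ] E) (v : E) : ℕ → ℝ → E
  | 0 => fun _ => v
  | n + 1 => fun t => ∫ s in (0 : ℝ)..t, A s (picardTerm A v n s)

theorem continuous_picardTerm {A : ℝ → E →L[ℝ] E} (hA : Continuous A) (v : E) (n : ℕ) : Continuous (picardTerm A v n) := by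
  induction n with
  | zero => exact continuous_const
  | succ n ih =>
    exact intervalIntegral.continuous_primitive
      (fun a b => (hA.clm_apply ih).intervalIntegrable a b) 0

theorem hasDerivAt_picardTerm_succ [CompleteSpace E]
    {A : ℝ → E →L[ℝ] E} (hA : Continuous A) (v : E) (n : ℕ) (t : ℝ) :
    HasDerivAt (picardTerm A v (n + 1)) (A t (picardTerm A v n t)) t :=
  ((hA.clm_apply (continuous_picardTerm hA v n)).integral_hasStrictDerivAt 0 t).hasDerivAt

theorem norm_picardTerm_le {A : ℝ → E →L[ℝ] E} (v : E)
    {C : ℝ} (hC : ∀ t, ‖A t‖ ≤ C) (n : ℕ) (t : ℝ) :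
    ‖picardTerm A v n t‖ ≤ ‖v‖ * ((C * |t|) ^ n / n.factorial) := by
  have hC0 : 0 ≤ C := (norm_nonneg _).trans (hC 0)
  induction n generalizing t with
  | zero => simp [picardTerm]
  | succ n ih =>
    -- Rescaling to `[0, 1]` treats both signs of `t` at once.
    have h1 : picardTerm A v (n + 1) t
        = t • ∫ s in (0 : ℝ)..1, A (t * s) (picardTerm A v n (t * s)) := by
      have := intervalIntegral.smul_integral_comp_mul_left (a := (0 : ℝ)) (b := 1)
        (fun s => A s (picardTerm A v n s)) t
      rw [this]; simp [picardTerm]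
    have h2 : ‖∫ s in (0 : ℝ)..1, A (t * s) (picardTerm A v n (t * s))‖
        ≤ ∫ s in (0 : ℝ)..1, (C * ‖v‖ * ((C * |t|) ^ n / n.factorial)) * s ^ n := by
      apply intervalIntegral.norm_integral_le_of_norm_le zero_le_one
      · refine Filter.Eventually.of_forall fun s hs => ?_
        have hs0 : 0 ≤ s := hs.1.le
        calc ‖A (t * s) (picardTerm A v n (t * s))‖
            ≤ ‖A (t * s)‖ * ‖picardTerm A v n (t * s)‖ := ContinuousLinearMap.le_opNorm _ _
          _ ≤ C * (‖v‖ * ((C * |t * s|) ^ n / n.factorial)) :=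
              mul_le_mul (hC _) (ih _) (norm_nonneg _) hC0
          _ = _ := by rw [abs_mul, abs_of_nonneg hs0]; ring
      · exact (by fun_prop : Continuous fun s : ℝ =>
          (C * ‖v‖ * ((C * |t|) ^ n / n.factorial)) * s ^ n).intervalIntegrable _ _
    rw [h1, norm_smul, Real.norm_eq_abs]
    refine (mul_le_mul_of_nonneg_left h2 (abs_nonneg t)).trans (le_of_eq ?_)
    rw [intervalIntegral.integral_const_mul, integral_pow, Nat.factorial_succ]
    have : (n.factorial : ℝ) ≠ 0 := by positivity
    have : (n + 1 : ℝ) ≠ 0 := by positivity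
    push_cast
    field_simp
    simp [pow_succ]
    ring

/-- Global existence for a linear equation with bounded continuous coefficients. -/
theorem exists_linearODE_solution [CompleteSpace E]
    {A : ℝ → E →L[ℝ] E} (hA : Continuous A) (v : E) {C : ℝ} (hC : ∀ t, ‖A t‖ ≤ C) :
    ∃ Y : ℝ → E, Y 0 = v ∧ ∀ t, HasDerivAt Y (A t (Y t)) t := by
  have hC0 : 0 ≤ C := (norm_nonneg _).trans (hC 0)
  have hsum : ∀ t, Summable fun n => picardTerm A v n t := fun t =>
    Summable.of_norm_bounded ((Real.summable_pow_div_factorial (C * |t|)).mul_left ‖v‖)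
      fun n => norm_picardTerm_le v hC n t
  have hsumS : ∀ t, Summable fun n => picardTerm A v (n + 1) t := fun t =>
    (summable_nat_add_iff 1).2 (hsum t)
  refine ⟨fun t => v + ∑' n, picardTerm A v (n + 1) t, ?_, fun t => ?_⟩
  · simp [picardTerm]
  · have key := hasDerivAt_tsum_of_isPreconnected
      (u := fun n => C * (‖v‖ * ((C * (|t| + 1)) ^ n / n.factorial)))
      (g := fun n => picardTerm A v (n + 1))
      (g' := fun n s => A s (picardTerm A v n s)) (t := Set.Ioo (-(|t| + 1)) (|t| + 1))
      (y₀ := t) (y := t)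
      (((Real.summable_pow_div_factorial _).mul_left _).mul_left _) isOpen_Ioo isPreconnected_Ioo
      (fun n y _ => hasDerivAt_picardTerm_succ hA v n y)
      (fun n y hy => by
        refine (ContinuousLinearMap.le_opNorm _ _).trans ?_
        refine mul_le_mul (hC _) ((norm_picardTerm_le v hC n y).trans ?_) (norm_nonneg _) hC0
        have : |y| ≤ |t| + 1 := (abs_lt.2 hy).le
        gcongr)
      (by constructor <;> linarith [neg_abs_le t, le_abs_self t]) (hsumS t)
      (by constructor <;> linarith [neg_abs_le t, le_abs_self t])
    have h2 := key.const_add v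
    convert h2 using 1
    rw [← (A t).map_tsum (hsum t), (hsum t).tsum_eq_zero_add]
    rfl

theorem linearODE_unique {A : ℝ → E →L[ℝ] E} (hA : Continuous A) {Y Z : ℝ → E} {t₀ : ℝ}
    (hY : ∀ t, HasDerivAt Y (A t (Y t)) t) (hZ : ∀ t, HasDerivAt Z (A t (Z t)) t)
    (h : Y t₀ = Z t₀) : Y = Z := by
  funext t
  set N := |t| + |t₀| + 1 with hN
  have ht : t ∈ Set.Ioo (-N) N := abs_lt.1 (by linarith [abs_nonneg t₀])
  have ht₀ : t₀ ∈ Set.Ioo (-N) N := abs_lt.1 (by linarith [abs_nonneg t])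
  obtain ⟨C, hC⟩ := isCompact_Icc.exists_bound_of_continuousOn
    (s := Set.Icc (-N) N) (f := A) hA.continuousOn
  refine ODE_solution_unique_of_mem_Ioo (v := fun t y => A t y) (s := fun _ => Set.univ)
    (K := C.toNNReal) (fun t ht => ?_) ht₀ (fun t _ => ⟨hY t, trivial⟩)
    (fun t _ => ⟨hZ t, trivial⟩) h ht
  refine ((A t).lipschitz.weaken ?_).lipschitzOnWith
  exact NNReal.coe_le_coe.1 ((hC t ⟨ht.1.le, ht.2.le⟩).trans (Real.le_coe_toNNReal C))

end LinearODE

/-! ### Holomorphic dependence on a parameter -/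

section Parameter

variable {E : Type*} [NormedAddCommGroup E] [NormedSpace ℂ E] [CompleteSpace E]

/-- Solutions of `Y' = (A(t) + ν B) Y` with fixed initial value depend holomorphically on `ν`. -/
theorem differentiable_linearODE_parameter {A : ℝ → E →L[ℂ] E} (hA : Continuous A) {C : ℝ}
    (hC : ∀ t, ‖A t‖ ≤ C) (B : E →L[ℂ] E) (v : E) {Y : ℂ → ℝ → E} (hY0 : ∀ ν, Y ν 0 = v)
    (hY : ∀ ν t, HasDerivAt (Y ν) (A t (Y ν t) + ν • B (Y ν t)) t) {T : ℝ} (hT : 0 ≤ T) :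
    Differentiable ℂ fun ν => Y ν T := by
  intro ν₀
  -- the variational equation, solved together with the equation itself
  obtain ⟨Z, hZ0, hZ⟩ : ∃ Z : ℝ → E, Z 0 = 0 ∧
      ∀ t, HasDerivAt Z (A t (Z t) + ν₀ • B (Z t) + B (Y ν₀ t)) t := by
    -- The forced equation for `Z` is the second row of a homogeneous linear system on `E × E` whose
    -- first row is the original equation, so the homogeneous existence theorem suffices.
    let F := ContinuousLinearMap.fst ℂ E E
    let S := ContinuousLinearMap.snd ℂ E E
    let I₁ := ContinuousLinearMap.inl ℂ E E
    let I₂ := ContinuousLinearMap.inr ℂ E E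
    let A₀ : (E × E) →L[ℂ] (E × E) :=
      I₁.comp ((ν₀ • B).comp F) + I₂.comp ((ν₀ • B).comp S + B.comp F)
    let 𝒜 : ℝ → (E × E) →L[ℂ] (E × E) := fun t =>
      I₁.comp ((A t).comp F) + I₂.comp ((A t).comp S) + A₀
    have h𝒜c : Continuous 𝒜 := by
      refine Continuous.add (Continuous.add ?_ ?_) continuous_const
      · exact continuous_const.clm_comp (hA.clm_comp continuous_const)
      · exact continuous_const.clm_comp (hA.clm_comp continuous_const)
    have hC0 : 0 ≤ C := (norm_nonneg _).trans (hC 0)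
    have h𝒜b : ∀ t, ‖𝒜 t‖ ≤ ‖I₁‖ * (C * ‖F‖) + ‖I₂‖ * (C * ‖S‖) + ‖A₀‖ := by
      intro t
      refine (norm_add_le _ _).trans (add_le_add_left ((norm_add_le _ _).trans ?_) _)
      refine add_le_add ?_ ?_
      · refine (ContinuousLinearMap.opNorm_comp_le _ _).trans ?_
        gcongr
        exact (ContinuousLinearMap.opNorm_comp_le _ _).trans (by gcongr; exact hC t)
      · refine (ContinuousLinearMap.opNorm_comp_le _ _).trans ?_
        gcongr
        exact (ContinuousLinearMap.opNorm_comp_le _ _).trans (by gcongr; exact hC t)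
    obtain ⟨X, hX0, hX⟩ := exists_linearODE_solution
      (A := fun t => (𝒜 t).restrictScalars ℝ)
      ((ContinuousLinearMap.restrictScalarsL ℂ (E × E) (E × E) ℝ ℝ).continuous.comp h𝒜c)
      ((v, 0) : E × E) (C := ‖I₁‖ * (C * ‖F‖) + ‖I₂‖ * (C * ‖S‖) + ‖A₀‖)
      (fun t => by rw [ContinuousLinearMap.norm_restrictScalars]; exact h𝒜b t)
    have hfst : ∀ t, HasDerivAt (fun t => (X t).1) (A t (X t).1 + ν₀ • B (X t).1) t := by
      intro t
      have := (ContinuousLinearMap.fst ℝ E E).hasFDerivAt.comp_hasDerivAt t (hX t)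
      simpa [𝒜, A₀, I₁, I₂, F, S, Function.comp_def] using this
    have hsnd : ∀ t, HasDerivAt (fun t => (X t).2)
        (A t (X t).2 + (ν₀ • B (X t).2 + B (X t).1)) t := by
      intro t
      have := (ContinuousLinearMap.snd ℝ E E).hasFDerivAt.comp_hasDerivAt t (hX t)
      simpa [𝒜, A₀, I₁, I₂, F, S, Function.comp_def] using this
    have hEq : (fun t => (X t).1) = Y ν₀ := by
      refine linearODE_unique (A := fun t => (A t + ν₀ • B).restrictScalars ℝ)
        (t₀ := 0) ?_ (fun t => ?_) (fun t => ?_) ?_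
      · exact (ContinuousLinearMap.restrictScalarsL ℂ E E ℝ ℝ).continuous.comp
          (hA.add continuous_const)
      · simpa using hfst t
      · simpa using hY ν₀ t
      · simp [hX0, hY0]
    refine ⟨fun t => (X t).2, by simp [hX0], fun t => ?_⟩
    rw [← congrFun hEq t, add_assoc]
    exact hsnd t
  have hZc : Continuous Z := continuous_iff_continuousAt.2 fun t => (hZ t).continuousAt
  obtain ⟨M, hM⟩ := isCompact_Icc.exists_bound_of_continuousOn
    (s := Set.Icc 0 T) (f := fun t => B (Z t)) (B.continuous.comp hZc).continuousOn
  have hM0 : 0 ≤ M := (norm_nonneg _).trans (hM 0 ⟨le_rfl, hT⟩)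
  have hC0 : 0 ≤ C := (norm_nonneg _).trans (hC 0)
  -- `C + (‖ν₀‖ + 1) ‖B‖` bounds the coefficient for `‖ν - ν₀‖ < 1`; the extra 1 makes `K` nonzero,
  -- as the exponential form of Gronwall's bound requires.
  set K : ℝ := C + (‖ν₀‖ + 1) * ‖B‖ + 1 with hK
  have hKpos : 0 < K := by positivity
  have hbound : ∀ᶠ ν in 𝓝 ν₀, ‖Y ν T - Y ν₀ T - (ν - ν₀) • Z T‖
      ≤ (M / K * (Real.exp (K * T) - 1)) * ‖ν - ν₀‖ ^ 2 := by
    filter_upwards [Metric.ball_mem_nhds ν₀ one_pos] with ν hν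
    have hν1 : ‖ν‖ ≤ ‖ν₀‖ + 1 := by
      have : ‖ν - ν₀‖ < 1 := by simpa [dist_eq_norm] using hν
      calc ‖ν‖ = ‖ν₀ + (ν - ν₀)‖ := by congr 1; ring
        _ ≤ _ := (norm_add_le _ _).trans (by linarith)
    -- The first-order remainder starts at 0 and is forced only by `(ν - ν₀)² B Z`, so Gronwall
    -- makes it quadratic in `ν - ν₀`.
    let R : ℝ → E := fun t => Y ν t - Y ν₀ t - (ν - ν₀) • Z t
    have hR : ∀ t, HasDerivAt R (A t (R t) + ν • B (R t) + (ν - ν₀) ^ 2 • B (Z t)) t := by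
      intro t
      refine (((hY ν t).sub (hY ν₀ t)).sub ((hZ t).const_smul (ν - ν₀))).congr_deriv ?_
      simp only [R, map_sub, map_smul]
      module
    have := norm_le_gronwallBound_of_norm_deriv_right_le (f := R) (δ := 0) (K := K)
      (ε := ‖ν - ν₀‖ ^ 2 * M) (a := 0) (b := T)
      (f' := fun t => A t (R t) + ν • B (R t) + (ν - ν₀) ^ 2 • B (Z t))
      (fun t _ => (hR t).continuousAt.continuousWithinAt)
      (fun t _ => (hR t).hasDerivWithinAt) (by simp [R, hY0, hZ0])
      (fun t ht => by
        refine (norm_add_le _ _).trans (add_le_add ((norm_add_le _ _).trans ?_) ?_)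
        · have h1 : ‖A t (R t)‖ ≤ C * ‖R t‖ := ((A t).le_opNorm _).trans (by gcongr; exact hC t)
          have h2 : ‖ν • B (R t)‖ ≤ (‖ν₀‖ + 1) * (‖B‖ * ‖R t‖) := by
            rw [norm_smul]
            exact mul_le_mul hν1 (B.le_opNorm _) (norm_nonneg _) (by positivity)
          rw [hK]; nlinarith [norm_nonneg (R t)]
        · rw [norm_smul, norm_pow]
          gcongr
          exact hM t ⟨ht.1, ht.2.le⟩) T ⟨hT, le_rfl⟩
    rw [gronwallBound_of_K_ne_0 hKpos.ne'] at this
    refine this.trans (le_of_eq ?_)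
    simp only [sub_zero, zero_mul, zero_add]; ring
  refine HasDerivAt.differentiableAt (f' := Z T) ?_
  rw [hasDerivAt_iff_isLittleO]
  refine (Asymptotics.IsBigO.of_bound (g := fun ν : ℂ => (ν - ν₀) ^ 2) _
    (hbound.mono fun ν h => by rwa [norm_pow])).trans_isLittleO ?_
  have hlit : (fun ν : ℂ => (ν - ν₀) ^ 2) =o[𝓝 ν₀] fun ν => ν - ν₀ := by
    have h0 : Filter.Tendsto (fun ν : ℂ => ν - ν₀) (𝓝 ν₀) (𝓝 0) := by
      have : Continuous fun ν : ℂ => ν - ν₀ := by fun_prop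
      simpa using this.tendsto ν₀
    simpa [Function.comp_def] using (Asymptotics.isLittleO_pow_id (𝕜 := ℂ) one_lt_two).comp_tendsto h0
  exact hlit

end Parameter

namespace KleinGordon

/-! ### Hill's equation, its discriminant and its multipliers -/

section Hill

variable {P : ℝ → ℝ} {K T : ℝ} {ν : ℂ}

/-- The phase-space vector field of `y'' + P y = 0`. -/
noncomputable def hillField (P : ℝ → ℝ) (t : ℝ) : (ℂ × ℂ) →L[ℂ] (ℂ × ℂ) :=
  (ContinuousLinearMap.inl ℂ ℂ ℂ).comp (ContinuousLinearMap.snd ℂ ℂ ℂ)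
    - (P t : ℂ) • (ContinuousLinearMap.inr ℂ ℂ ℂ).comp (ContinuousLinearMap.fst ℂ ℂ ℂ)

/-- The dependence of the phase-space vector field of Hill's equation on `ν`. -/
noncomputable def hillParameterField : (ℂ × ℂ) →L[ℂ] (ℂ × ℂ) :=
  (ContinuousLinearMap.inr ℂ ℂ ℂ).comp (ContinuousLinearMap.fst ℂ ℂ ℂ)

theorem hillField_apply (t : ℝ) (x : ℂ × ℂ) :
    hillField P t x + ν • hillParameterField x = (x.2, ν * x.1 - P t * x.1) := by
  ext <;> simp [hillField, hillParameterField]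
  ring

theorem continuous_hillField (hP : Continuous P) : Continuous (hillField P) :=
  continuous_const.sub ((Complex.continuous_ofReal.comp hP).smul continuous_const)

theorem norm_hillField_le (hK : ∀ t, |P t| ≤ K) (t : ℝ) :
    ‖hillField P t‖ ≤ ‖(ContinuousLinearMap.inl ℂ ℂ ℂ).comp (ContinuousLinearMap.snd ℂ ℂ ℂ)‖
      + K * ‖hillParameterField‖ := by
  refine (norm_sub_le _ _).trans ?_
  gcongr
  rw [norm_smul, Complex.norm_real]
  exact mul_le_mul_of_nonneg_right (hK t) (norm_nonneg _)

theorem IsHillSol.hasDerivAt {y : ℝ → ℂ} (h : IsHillSol P ν y) (t : ℝ) :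
    HasDerivAt y (deriv y t) t :=
  (h.1.differentiable (by norm_num) t).hasDerivAt

theorem IsHillSol.hasDerivAt_deriv {y : ℝ → ℂ} (h : IsHillSol P ν y) (t : ℝ) :
    HasDerivAt (deriv y) (ν * y t - P t * y t) t := by
  have h1 : ContDiff ℝ 1 (deriv y) := (contDiff_succ_iff_deriv (n := 1).1 h.1).2.2
  have h2 := (h1.differentiable (by norm_num) t).hasDerivAt
  rwa [eq_sub_of_add_eq (h.2 t)] at h2

theorem IsHillSol.of_hasDerivAt {y z : ℝ → ℂ} (hP : Continuous P)
    (hy : ∀ t, HasDerivAt y (z t) t) (hz : ∀ t, HasDerivAt z (ν * y t - P t * y t) t) :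
    IsHillSol P ν y := by
  have hd : deriv y = z := funext fun t => (hy t).deriv
  have hd2 : deriv z = fun t => ν * y t - P t * y t := funext fun t => (hz t).deriv
  have hyc : Continuous y := continuous_iff_continuousAt.2 fun t => (hy t).continuousAt
  refine ⟨?_, fun t => by rw [hd, hd2]; ring⟩
  refine contDiff_succ_iff_deriv (n := 1).2 ⟨fun t => (hy t).differentiableAt, by simp, ?_⟩
  rw [hd, contDiff_one_iff_deriv]
  refine ⟨fun t => (hz t).differentiableAt, ?_⟩
  rw [hd2]
  fun_prop

theorem IsHillSol.hasDerivAt_pair {y : ℝ → ℂ} (h : IsHillSol P ν y) (t : ℝ) :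
    HasDerivAt (fun t => (y t, deriv y t))
      (hillField P t (y t, deriv y t) + ν • hillParameterField (y t, deriv y t)) t := by
  rw [hillField_apply]
  exact (h.hasDerivAt t).prodMk (h.hasDerivAt_deriv t)

theorem exists_isHillSol (hP : Continuous P) (hK : ∀ t, |P t| ≤ K) (ν a b : ℂ) :
    ∃ y, IsHillSol P ν y ∧ y 0 = a ∧ deriv y 0 = b := by
  obtain ⟨Y, hY0, hY⟩ := exists_linearODE_solution
    (A := fun t => (hillField P t + ν • hillParameterField).restrictScalars ℝ)
    ((ContinuousLinearMap.restrictScalarsL ℂ (ℂ × ℂ) (ℂ × ℂ) ℝ ℝ).continuous.comp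
      ((continuous_hillField hP).add continuous_const)) ((a, b) : ℂ × ℂ)
    (C := ‖(ContinuousLinearMap.inl ℂ ℂ ℂ).comp (ContinuousLinearMap.snd ℂ ℂ ℂ)‖
      + K * ‖hillParameterField‖ + ‖ν • hillParameterField‖)
    (fun t => by
      rw [ContinuousLinearMap.norm_restrictScalars]
      exact (norm_add_le _ _).trans (by gcongr; exact norm_hillField_le hK t))
  have hY' : ∀ t, HasDerivAt Y ((Y t).2, ν * (Y t).1 - P t * (Y t).1) t := fun t => by
    rw [← hillField_apply]; exact hY t
  have h1 : ∀ t, HasDerivAt (fun t => (Y t).1) (Y t).2 t := fun t => by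
    simpa [Function.comp_def] using
      (ContinuousLinearMap.fst ℝ ℂ ℂ).hasFDerivAt.comp_hasDerivAt t (hY' t)
  have h2 : ∀ t, HasDerivAt (fun t => (Y t).2) (ν * (Y t).1 - P t * (Y t).1) t := fun t => by
    simpa [Function.comp_def] using
      (ContinuousLinearMap.snd ℝ ℂ ℂ).hasFDerivAt.comp_hasDerivAt t (hY' t)
  refine ⟨fun t => (Y t).1, IsHillSol.of_hasDerivAt hP h1 h2, by simp [hY0], ?_⟩
  rw [(h1 0).deriv, hY0]

theorem IsHillSol.unique (hP : Continuous P) {y z : ℝ → ℂ} (hy : IsHillSol P ν y)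
    (hz : IsHillSol P ν z) {t₀ : ℝ} (h0 : y t₀ = z t₀) (h1 : deriv y t₀ = deriv z t₀) :
    y = z := by
  have := linearODE_unique (t₀ := t₀)
    (A := fun t => (hillField P t + ν • hillParameterField).restrictScalars ℝ)
    ((ContinuousLinearMap.restrictScalarsL ℂ (ℂ × ℂ) (ℂ × ℂ) ℝ ℝ).continuous.comp
      ((continuous_hillField hP).add continuous_const))
    hy.hasDerivAt_pair hz.hasDerivAt_pair (Prod.ext h0 h1)
  exact funext fun t => congrArg Prod.fst (congrFun this t)

theorem hillSol_spec (hP : Continuous P) (hK : ∀ t, |P t| ≤ K) (ν a b : ℂ) :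
    IsHillSol P ν (hillSol P ν a b) ∧ hillSol P ν a b 0 = a ∧ deriv (hillSol P ν a b) 0 = b :=
  Classical.epsilon_spec (exists_isHillSol hP hK ν a b)

theorem IsHillSol.lincomb {y z : ℝ → ℂ} (hP : Continuous P) (hy : IsHillSol P ν y)
    (hz : IsHillSol P ν z) (a b : ℂ) :
    IsHillSol P ν (fun t => a * y t + b * z t) ∧
      deriv (fun t => a * y t + b * z t) = fun t => a * deriv y t + b * deriv z t := by
  have h1 : ∀ t, HasDerivAt (fun t => a * y t + b * z t) (a * deriv y t + b * deriv z t) t :=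
    fun t => ((hy.hasDerivAt t).const_mul a).add ((hz.hasDerivAt t).const_mul b)
  refine ⟨IsHillSol.of_hasDerivAt hP h1 fun t => ?_, funext fun t => (h1 t).deriv⟩
  exact (((hy.hasDerivAt_deriv t).const_mul a).add
    ((hz.hasDerivAt_deriv t).const_mul b)).congr_deriv (by ring)

theorem IsHillSol.eq_lincomb (hP : Continuous P) (hK : ∀ t, |P t| ≤ K) {y : ℝ → ℂ}
    (hy : IsHillSol P ν y) :
    y = fun t => y 0 * hillSol P ν 1 0 t + deriv y 0 * hillSol P ν 0 1 t := by
  obtain ⟨h1, h1a, h1b⟩ := hillSol_spec hP hK ν 1 0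
  obtain ⟨h2, h2a, h2b⟩ := hillSol_spec hP hK ν 0 1
  obtain ⟨h3, h4⟩ := h1.lincomb hP h2 (y 0) (deriv y 0)
  exact hy.unique hP h3 (t₀ := 0) (by simp [h1a, h2a]) (by simp [h4, h1b, h2b])

theorem IsHillSol.comp_add_period (hP : Continuous P) (hPT : Function.Periodic P T) {y : ℝ → ℂ}
    (hy : IsHillSol P ν y) :
    IsHillSol P ν (fun t => y (t + T)) ∧
      deriv (fun t => y (t + T)) = fun t => deriv y (t + T) := by
  have h1 : ∀ t, HasDerivAt (fun t => y (t + T)) (deriv y (t + T)) t :=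
    fun t => (hy.hasDerivAt (t + T)).comp_add_const t T
  refine ⟨IsHillSol.of_hasDerivAt hP h1 fun t => ?_, funext fun t => (h1 t).deriv⟩
  have := (hy.hasDerivAt_deriv (t + T)).comp_add_const t T
  rwa [hPT t] at this

/-- There is no first-order term, so the Wronskian is constant. -/
theorem det_hillMonodromy (hP : Continuous P) (hK : ∀ t, |P t| ≤ K) (ν : ℂ) :
    (hillMonodromy P T ν).det = 1 := by
  obtain ⟨h1, h1a, h1b⟩ := hillSol_spec hP hK ν 1 0
  obtain ⟨h2, h2a, h2b⟩ := hillSol_spec hP hK ν 0 1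
  set y := hillSol P ν 1 0
  set z := hillSol P ν 0 1
  have hW : ∀ t, HasDerivAt (fun t => y t * deriv z t - z t * deriv y t) 0 t := fun t =>
    (((h1.hasDerivAt t).mul (h2.hasDerivAt_deriv t)).sub
      ((h2.hasDerivAt t).mul (h1.hasDerivAt_deriv t))).congr_deriv (by ring)
  have := is_const_of_deriv_eq_zero (fun t => (hW t).differentiableAt)
    (fun t => (hW t).deriv) T 0
  simp only [h1a, h1b, h2a, h2b] at this
  rw [hillMonodromy, Matrix.det_fin_two_of, this]
  ring

theorem det_hillMonodromy_sub (hP : Continuous P) (hK : ∀ t, |P t| ≤ K) (ν μ : ℂ) :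
    (hillMonodromy P T ν - μ • (1 : Matrix (Fin 2) (Fin 2) ℂ)).det
      = μ ^ 2 - hillDiscriminant P T ν * μ + 1 := by
  have := det_hillMonodromy (T := T) hP hK ν
  rw [Matrix.det_fin_two] at this
  rw [hillDiscriminant, Matrix.det_fin_two, Matrix.trace_fin_two]
  simp
  linear_combination this

theorem differentiable_hillDiscriminant (hP : Continuous P) (hK : ∀ t, |P t| ≤ K) (hT : 0 ≤ T) :
    Differentiable ℂ (hillDiscriminant P T) := by
  have key : ∀ a b : ℂ, Differentiable ℂ fun ν => (hillSol P ν a b T, deriv (hillSol P ν a b) T) :=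
    fun a b => differentiable_linearODE_parameter (A := hillField P) (continuous_hillField hP)
      (norm_hillField_le hK) hillParameterField ((a, b) : ℂ × ℂ)
      (Y := fun ν t => (hillSol P ν a b t, deriv (hillSol P ν a b) t))
      (fun ν => Prod.ext (hillSol_spec hP hK ν a b).2.1 (hillSol_spec hP hK ν a b).2.2)
      (fun ν t => (hillSol_spec hP hK ν a b).1.hasDerivAt_pair t) hT
  have h : hillDiscriminant P T
      = fun ν => hillSol P ν 1 0 T + deriv (hillSol P ν 0 1) T := by
    funext ν; simp [hillDiscriminant, hillMonodromy, Matrix.trace_fin_two]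
  rw [h]
  exact (key 1 0).fst.add (key 0 1).snd

/-- For real `ν`, complex conjugation preserves the equation, and by uniqueness it fixes every
solution with real initial data. -/
theorem hillDiscriminant_ofReal_im (hP : Continuous P) (hK : ∀ t, |P t| ≤ K) (x : ℝ) :
    (hillDiscriminant P T x).im = 0 := by
  have conj : ∀ a b : ℝ, (hillSol P x a b = fun t => (starRingEnd ℂ) (hillSol P x a b t)) ∧
      (deriv (hillSol P x a b) = fun t => (starRingEnd ℂ) (deriv (hillSol P x a b) t)) := by
    intro a b
    obtain ⟨h, ha, hb⟩ := hillSol_spec hP hK x a b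
    set y := hillSol P x a b
    have h1 : ∀ t, HasDerivAt (fun t => (starRingEnd ℂ) (y t)) ((starRingEnd ℂ) (deriv y t)) t :=
      fun t => by simpa [Function.comp_def] using
        Complex.conjCLE.toContinuousLinearMap.hasFDerivAt.comp_hasDerivAt t (h.hasDerivAt t)
    have h2 : ∀ t, HasDerivAt (fun t => (starRingEnd ℂ) (deriv y t))
        (x * (starRingEnd ℂ) (y t) - P t * (starRingEnd ℂ) (y t)) t :=
      fun t => by simpa [Function.comp_def] using
        Complex.conjCLE.toContinuousLinearMap.hasFDerivAt.comp_hasDerivAt t (h.hasDerivAt_deriv t)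
    have hd := funext fun t => (h1 t).deriv
    have h3 := h.unique hP (IsHillSol.of_hasDerivAt hP h1 h2) (t₀ := 0) (by simp [ha])
      (by rw [hd]; simp [hb])
    exact ⟨h3, by rw [← hd, ← h3]⟩
  have e1 := congrFun (conj 1 0).1 T
  have e2 := congrFun (conj 0 1).2 T
  simp only [Complex.ofReal_one, Complex.ofReal_zero] at e1 e2
  have i1 := Complex.conj_eq_iff_im.1 e1.symm
  have i2 := Complex.conj_eq_iff_im.1 e2.symm
  simp [hillDiscriminant, hillMonodromy, Matrix.trace_fin_two, i1, i2]

/-- A root of the characteristic polynomial of the monodromy matrix is a Floquet multiplier. -/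
theorem exists_floquet_solution (hP : Continuous P) (hK : ∀ t, |P t| ≤ K)
    (hPT : Function.Periodic P T) {μ : ℂ} (hμ : μ ^ 2 - hillDiscriminant P T ν * μ + 1 = 0) :
    ∃ y, IsHillSol P ν y ∧ y ≠ 0 ∧ ∀ t, y (t + T) = μ * y t := by
  rw [← det_hillMonodromy_sub hP hK] at hμ
  obtain ⟨v, hv0, hv⟩ := Matrix.exists_mulVec_eq_zero_iff.2 hμ
  have e0 := congrFun hv 0
  have e1 := congrFun hv 1
  simp [Matrix.mulVec, dotProduct, Fin.sum_univ_two, hillMonodromy] at e0 e1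
  obtain ⟨h1, h1a, h1b⟩ := hillSol_spec hP hK ν 1 0
  obtain ⟨h2, h2a, h2b⟩ := hillSol_spec hP hK ν 0 1
  obtain ⟨h3, h4⟩ := h1.lincomb hP h2 (v 0) (v 1)
  refine ⟨_, h3, fun h => hv0 ?_, fun t => ?_⟩
  · have d := h4
    rw [h] at d
    have a0 := congrFun h 0
    have b0 := congrFun d 0
    simp [h1a, h2a, h1b, h2b] at a0 b0
    ext i; fin_cases i
    · simpa using a0
    · simpa using b0.symm
  · obtain ⟨h5, h6⟩ := h3.comp_add_period hP hPT
    obtain ⟨h7, h8⟩ := h3.lincomb hP h3 μ 0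
    have := h5.unique hP h7 (t₀ := 0)
      (by simp [h1a, h2a]; linear_combination e0)
      (by rw [h6, h8, h4]; simp [h1b, h2b]; linear_combination e1)
    simpa using congrFun this t

/-- The initial data of a periodic solution form an eigenvector of the monodromy matrix for the
multiplier 1. Applied to `f'`, this gives `Δ(0) = 2`. -/
theorem hillDiscriminant_eq_two_of_periodic (hP : Continuous P) (hK : ∀ t, |P t| ≤ K)
    {y : ℝ → ℂ} (hy : IsHillSol P ν y) (hy0 : y ≠ 0) (hyT : Function.Periodic y T) :
    hillDiscriminant P T ν = 2 := by
  have hc := hy.eq_lincomb hP hK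
  obtain ⟨h1, h1a, h1b⟩ := hillSol_spec hP hK ν 1 0
  obtain ⟨h2, h2a, h2b⟩ := hillSol_spec hP hK ν 0 1
  have hd : deriv y = fun t => y 0 * deriv (hillSol P ν 1 0) t
      + deriv y 0 * deriv (hillSol P ν 0 1) t := by
    conv_lhs => rw [hc]
    exact (h1.lincomb hP h2 (y 0) (deriv y 0)).2
  have hdT : deriv y T = deriv y 0 := by
    have := congrFun (congrArg deriv (funext hyT)) 0
    rwa [deriv_comp_add_const, zero_add] at this
  have e0 := congrFun hc T
  have e1 := congrFun hd T
  have hT0 : y T = y 0 := by simpa using hyT 0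
  have hdet : (hillMonodromy P T ν - (1 : ℂ) • (1 : Matrix (Fin 2) (Fin 2) ℂ)).det = 0 := by
    refine Matrix.exists_mulVec_eq_zero_iff.1 ⟨![y 0, deriv y 0], fun h => hy0 ?_, ?_⟩
    · have a := congrFun h 0
      have b := congrFun h 1
      simp at a b
      rw [hc, a, b]; funext t; simp
    · ext i
      fin_cases i
      · simp [Matrix.mulVec, dotProduct, Fin.sum_univ_two, hillMonodromy]
        linear_combination hT0 - e0
      · simp [Matrix.mulVec, dotProduct, Fin.sum_univ_two, hillMonodromy]
        linear_combination hdT - e1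
  rw [det_hillMonodromy_sub hP hK] at hdet
  linear_combination -hdet

/-- Otherwise the real number `Δ` equals `2 cos θ` with `θ` real, and `exp (iθ)` is a unimodular
multiplier. -/
theorem sq_re_hillDiscriminant_gt (hP : Continuous P) (hK : ∀ t, |P t| ≤ K) {x : ℝ}
    (hx : (x : ℂ) ∉ hillSpectrum P T) : 4 < (hillDiscriminant P T x).re ^ 2 := by
  by_contra! hle
  set d := (hillDiscriminant P T x).re with hd
  have hD : hillDiscriminant P T x = (d : ℂ) :=
    Complex.ext rfl (by simpa using hillDiscriminant_ofReal_im hP hK x)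
  set θ := Real.arccos (d / 2)
  have hcos : Real.cos θ = d / 2 := Real.cos_arccos (by nlinarith) (by nlinarith)
  have hcosC : Complex.cos θ = (d / 2 : ℂ) := by exact_mod_cast congrArg Complex.ofReal hcos
  refine hx ⟨Complex.exp (θ * Complex.I), ?_, Complex.norm_exp_ofReal_mul_I θ⟩
  rw [spectrum.mem_iff, ← IsUnit.neg_iff, Matrix.isUnit_iff_isUnit_det, isUnit_iff_ne_zero,
    not_not, neg_sub, Algebra.algebraMap_eq_smul_one, det_hillMonodromy_sub hP hK, hD]
  have h1 : Complex.exp (θ * Complex.I) * Complex.exp (-(θ * Complex.I)) = 1 := by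
    rw [← Complex.exp_add]; simp
  have h2 := Complex.two_cos (θ : ℂ)
  rw [hcosC, neg_mul] at h2
  linear_combination Complex.exp (θ * Complex.I) * (-h2) - h1

end Hill


/-! ### From the wave to Hill's equation -/

section Wave

variable {V : ℝ → ℝ} {c T : ℝ} {f : ℝ → ℝ}

theorem IsPeriodicTravelingWave.period_pos (hf : IsPeriodicTravelingWave V c T f) : 0 < T :=
  hf.fundamental_period.1.1

theorem continuous_hillPotential (hV : ContDiff ℝ 2 V) (hf : Continuous f) :
    Continuous (hillPotential V c f) := by
  have h1 : ContDiff ℝ 1 (deriv V) := (contDiff_succ_iff_deriv (n := 1).1 hV).2.2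
  exact ((h1.continuous_deriv le_rfl).comp hf).div_const _

/-- The derivative of the profile solves Hill's equation with `ν = 0`. -/
theorem IsPeriodicTravelingWave.hasDerivAt_deriv_deriv (hV : ContDiff ℝ 2 V) (hc : c ^ 2 - 1 ≠ 0)
    (hf : IsPeriodicTravelingWave V c T f) (t : ℝ) :
    HasDerivAt (deriv f) (deriv (deriv f) t) t ∧
      HasDerivAt (deriv (deriv f)) (-(hillPotential V c f t * deriv f t)) t := by
  have h1 : ContDiff ℝ 1 (deriv V) := (contDiff_succ_iff_deriv (n := 1).1 hV).2.2
  have h2 : ContDiff ℝ 1 (deriv f) := (contDiff_succ_iff_deriv (n := 1).1 hf.contDiff).2.2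
  refine ⟨(h2.differentiable (by norm_num) t).hasDerivAt, ?_⟩
  have h3 : deriv (deriv f) = fun t => -(deriv V (f t)) / (c ^ 2 - 1) := by
    funext t
    rw [eq_div_iff hc]
    linarith [hf.ode t]
  rw [h3]
  refine ((((h1.differentiable (by norm_num) (f t)).hasDerivAt.comp t
    (hf.contDiff.differentiable (by norm_num) t).hasDerivAt).neg).div_const
      (c ^ 2 - 1)).congr_deriv ?_
  rw [hillPotential]; ring

theorem IsPeriodicTravelingWave.isHillSol (hV : ContDiff ℝ 2 V) (hc : c ^ 2 - 1 ≠ 0)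
    (hf : IsPeriodicTravelingWave V c T f) :
    IsHillSol (hillPotential V c f) 0 (fun t => ((deriv f t : ℝ) : ℂ)) := by
  refine IsHillSol.of_hasDerivAt (continuous_hillPotential hV hf.contDiff.continuous)
    (z := fun t => ((deriv (deriv f) t : ℝ) : ℂ))
    (fun t => (hf.hasDerivAt_deriv_deriv hV hc t).1.ofReal_comp) fun t => ?_
  refine (hf.hasDerivAt_deriv_deriv hV hc t).2.ofReal_comp.congr_deriv ?_
  push_cast; ring

/-- A constant profile has no least period: `T / 2` would be a smaller one. -/
theorem IsPeriodicTravelingWave.deriv_ne_zero (hf : IsPeriodicTravelingWave V c T f) :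
    (fun t => ((deriv f t : ℝ) : ℂ)) ≠ 0 := by
  intro h
  have h0 : ∀ t, deriv f t = 0 := fun t => by simpa using congrFun h t
  have hT := hf.period_pos
  have : T ≤ T / 2 := hf.fundamental_period.2 ⟨by linarith, fun t => by simp [h0]⟩
  linarith

/-- Only `f'` is assumed periodic, not `f`, so periodicity of `V''(f)` needs an argument. Comparing
`f''' = -P f'` at `t` and `t + T` gives `(P(t + T) - P(t)) f'(t) = 0`. Were the first factor nonzero
at some point, `f'` would vanish near it, hence everywhere by uniqueness. -/
theorem IsPeriodicTravelingWave.periodic_hillPotential (hV : ContDiff ℝ 2 V)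
    (hc : c ^ 2 - 1 ≠ 0) (hf : IsPeriodicTravelingWave V c T f) :
    Function.Periodic (hillPotential V c f) T := by
  have hP := continuous_hillPotential (c := c) hV hf.contDiff.continuous
  set P := hillPotential V c f
  have hper : Function.Periodic (deriv f) T := hf.fundamental_period.1.2
  have hmul : ∀ t, (P (t + T) - P t) * deriv f t = 0 := by
    intro t
    have h1 : Function.Periodic (deriv (deriv f)) T := fun t => by
      rw [← deriv_comp_add_const, funext hper]
    have h2 : deriv (deriv (deriv f)) (t + T) = deriv (deriv (deriv f)) t := by
      rw [← deriv_comp_add_const, funext h1]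
    rw [(hf.hasDerivAt_deriv_deriv hV hc _).2.deriv, (hf.hasDerivAt_deriv_deriv hV hc _).2.deriv,
      hper] at h2
    linarith
  have hsol := hf.isHillSol hV hc
  intro t
  by_contra hne
  have hev : ∀ᶠ s in 𝓝 t, deriv f s = 0 := by
    have hcont : ContinuousAt (fun s => P (s + T) - P s) t := by fun_prop
    filter_upwards [hcont.eventually_ne (sub_ne_zero.2 hne)] with s hs
    exact (mul_eq_zero.1 (hmul s)).resolve_left hs
  refine hf.deriv_ne_zero (hsol.unique hP (t₀ := t)
    (IsHillSol.of_hasDerivAt (y := 0) (z := 0) hP (fun s => hasDerivAt_const s (0 : ℂ))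
      fun s => by simp) ?_ ?_)
  · simp [hev.self_of_nhds]
  · refine Filter.EventuallyEq.deriv_eq ?_
    filter_upwards [hev] with s hs
    simp [hs]

theorem IsPeriodicTravelingWave.exists_hillPotential_bound (hV : ContDiff ℝ 2 V)
    (hc : c ^ 2 - 1 ≠ 0) (hf : IsPeriodicTravelingWave V c T f) :
    ∃ K, ∀ t, |hillPotential V c f t| ≤ K := by
  obtain ⟨K, hK⟩ := ((hf.periodic_hillPotential hV hc).isBounded_of_continuous
    hf.period_pos.ne' (continuous_hillPotential hV hf.contDiff.continuous)).exists_norm_le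
  exact ⟨K, fun t => hK _ ⟨t, rfl⟩⟩

theorem hasDerivAt_exp_mul (b : ℂ) (t : ℝ) :
    HasDerivAt (fun t : ℝ => Complex.exp (b * t)) (b * Complex.exp (b * t)) t := by
  have h := ((Complex.ofRealCLM.hasDerivAt (x := t)).const_mul b).cexp
  refine h.congr_deriv ?_
  simp [mul_comm]

theorem hasDerivAt_exp_mul_mul (b : ℂ) {w : ℝ → ℂ} {w' : ℂ} {t : ℝ} (h : HasDerivAt w w' t) :
    HasDerivAt (fun t : ℝ => Complex.exp (b * t) * w t)
      (Complex.exp (b * t) * (w' + b * w t)) t :=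
  ((hasDerivAt_exp_mul b t).mul h).congr_deriv (by ring)

/-- The gauge transformation that removes the first-order term of the linearized equation. -/
theorem IsHillSol.isLinearizedSol (hc : c ^ 2 - 1 ≠ 0) {lam : ℂ}
    {y : ℝ → ℂ} (hy : IsHillSol (hillPotential V c f) ((lam / (c ^ 2 - 1)) ^ 2) y) :
    IsLinearizedSol V c f lam (fun t => Complex.exp (c * lam / (c ^ 2 - 1) * t) * y t) ∧
      deriv (fun t : ℝ => Complex.exp (c * lam / (c ^ 2 - 1) * t) * y t) = fun t : ℝ =>
        Complex.exp (c * lam / (c ^ 2 - 1) * t) * (deriv y t + c * lam / (c ^ 2 - 1) * y t) := by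
  set b : ℂ := c * lam / (c ^ 2 - 1) with hb
  have hd1 : deriv (fun t : ℝ => Complex.exp (b * t) * y t) = fun t : ℝ =>
      Complex.exp (b * t) * (deriv y t + b * y t) :=
    funext fun t => (hasDerivAt_exp_mul_mul b (hy.hasDerivAt t)).deriv
  have hcC : (c : ℂ) ^ 2 - 1 ≠ 0 := by exact_mod_cast hc
  refine ⟨⟨?_, fun t => ?_⟩, hd1⟩
  · have : ContDiff ℝ 2 fun t : ℝ => Complex.exp (b * t) :=
      (contDiff_const.mul Complex.ofRealCLM.contDiff).cexp
    exact this.mul hy.1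
  · rw [hd1, (hasDerivAt_exp_mul_mul b (w := fun t => deriv y t + b * y t)
      ((hy.hasDerivAt_deriv t).add ((hy.hasDerivAt t).const_mul b))).deriv, hb]
    simp only [hillPotential]
    push_cast
    field_simp
    ring

theorem IsLinearizedSol.isHillSol (hV : ContDiff ℝ 2 V) (hf : Continuous f) (hc : c ^ 2 - 1 ≠ 0)
    {lam : ℂ} {w : ℝ → ℂ} (hw : IsLinearizedSol V c f lam w) :
    IsHillSol (hillPotential V c f) ((lam / (c ^ 2 - 1)) ^ 2)
      (fun t => Complex.exp (-(c * lam / (c ^ 2 - 1)) * t) * w t) ∧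
      deriv (fun t : ℝ => Complex.exp (-(c * lam / (c ^ 2 - 1)) * t) * w t) = fun t : ℝ =>
        Complex.exp (-(c * lam / (c ^ 2 - 1)) * t)
          * (deriv w t + -(c * lam / (c ^ 2 - 1)) * w t) := by
  set b : ℂ := -(c * lam / (c ^ 2 - 1)) with hb
  have hcC : (c : ℂ) ^ 2 - 1 ≠ 0 := by exact_mod_cast hc
  have hw1 : ∀ t, HasDerivAt w (deriv w t) t :=
    fun t => (hw.1.differentiable (by norm_num) t).hasDerivAt
  have hw2 : ∀ t, HasDerivAt (deriv w) (deriv (deriv w) t) t := fun t =>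
    ((contDiff_succ_iff_deriv (n := 1).1 hw.1).2.2.differentiable (by norm_num) t).hasDerivAt
  refine ⟨IsHillSol.of_hasDerivAt (continuous_hillPotential hV hf)
    (fun t => hasDerivAt_exp_mul_mul b (hw1 t)) fun t => ?_,
    funext fun t => (hasDerivAt_exp_mul_mul b (hw1 t)).deriv⟩
  refine (hasDerivAt_exp_mul_mul b (w := fun t => deriv w t + b * w t) ((hw2 t).add ((hw1 t).const_mul b))).congr_deriv ?_
  have h := hw.2 t
  have h' : deriv (deriv w) t = (2 * c * lam * deriv w t
      - (lam ^ 2 + ((deriv (deriv V) (f t) : ℝ) : ℂ)) * w t) / (c ^ 2 - 1) := by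
    rw [eq_div_iff hcC]; linear_combination h
  rw [h', hb]
  simp only [hillPotential]
  push_cast
  field_simp
  ring

/-- The gauge transformation proves that the solution chosen by `Classical.epsilon` exists and,
applied backwards with uniqueness for Hill's equation, identifies it. The shift in `y'(0)` comes
from differentiating the exponential factor. -/
theorem linearizedSol_eq (hV : ContDiff ℝ 2 V) (hc : c ^ 2 - 1 ≠ 0)
    (hf : IsPeriodicTravelingWave V c T f) (lam p q : ℂ) :
    ∃ y, IsHillSol (hillPotential V c f) ((lam / (c ^ 2 - 1)) ^ 2) y ∧ y 0 = p ∧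
      deriv y 0 = q - c * lam / (c ^ 2 - 1) * p ∧
      (∀ t : ℝ, linearizedSol V c f lam p q t = Complex.exp (c * lam / (c ^ 2 - 1) * t) * y t) ∧
      ∀ t : ℝ, deriv (linearizedSol V c f lam p q) t
        = Complex.exp (c * lam / (c ^ 2 - 1) * t) * (deriv y t + c * lam / (c ^ 2 - 1) * y t) := by
  have hP := continuous_hillPotential (c := c) hV hf.contDiff.continuous
  obtain ⟨K, hK⟩ := hf.exists_hillPotential_bound hV hc
  obtain ⟨h1, h1a, h1b⟩ := hillSol_spec hP hK ((lam / (c ^ 2 - 1)) ^ 2) p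
    (q - c * lam / (c ^ 2 - 1) * p)
  set y := hillSol (hillPotential V c f) ((lam / (c ^ 2 - 1)) ^ 2) p
    (q - c * lam / (c ^ 2 - 1) * p)
  obtain ⟨h2, h3⟩ := h1.isLinearizedSol hc
  obtain ⟨h4, h4a, h4b⟩ : IsLinearizedSol V c f lam (linearizedSol V c f lam p q) ∧
      linearizedSol V c f lam p q 0 = p ∧ deriv (linearizedSol V c f lam p q) 0 = q :=
    Classical.epsilon_spec (p := fun w => IsLinearizedSol V c f lam w ∧ w 0 = p ∧ deriv w 0 = q)
      ⟨_, h2, by simp [h1a], by rw [h3]; simp [h1a, h1b]⟩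
  obtain ⟨h5, h6⟩ := h4.isHillSol hV hf.contDiff.continuous hc
  have h7 := h5.unique hP h1 (t₀ := 0) (by simp [h1a, h4a])
    (by rw [h6, h1b]; simp [h4a, h4b]; ring)
  have h8 : linearizedSol V c f lam p q
      = fun t : ℝ => Complex.exp (c * lam / (c ^ 2 - 1) * t) * y t := by
    funext t
    rw [← congrFun h7 t, ← mul_assoc, ← Complex.exp_add]
    simp
  refine ⟨y, h1, h1a, h1b, fun t => congrFun h8 t, fun t => ?_⟩
  rw [h8, h3]

/-- Up to conjugation, the gauge multiplies the Hill monodromy matrix by `exp (c λ T / (c² - 1))`,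
and the Hill matrix has determinant 1. -/
theorem evans_one_eq (hV : ContDiff ℝ 2 V) (hc : c ^ 2 - 1 ≠ 0)
    (hf : IsPeriodicTravelingWave V c T f) (lam : ℂ) :
    evans V c T f lam 1 = Complex.exp (c * lam / (c ^ 2 - 1) * T) ^ 2
      - Complex.exp (c * lam / (c ^ 2 - 1) * T)
        * hillDiscriminant (hillPotential V c f) T ((lam / (c ^ 2 - 1)) ^ 2) + 1 := by
  have hP := continuous_hillPotential (c := c) hV hf.contDiff.continuous
  obtain ⟨K, hK⟩ := hf.exists_hillPotential_bound hV hc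
  set ν := (lam / ((c : ℂ) ^ 2 - 1)) ^ 2
  obtain ⟨y, hy, hya, hyb, hw, hw'⟩ := linearizedSol_eq hV hc hf lam 1 0
  obtain ⟨z, hz, hza, hzb, hv, hv'⟩ := linearizedSol_eq hV hc hf lam 0 1
  have hdet := det_hillMonodromy (T := T) hP hK ν
  obtain ⟨h1, -, -⟩ := hillSol_spec hP hK ν 1 0
  obtain ⟨h2, -, -⟩ := hillSol_spec hP hK ν 0 1
  have hy1 := hy.eq_lincomb hP hK
  have hz1 := hz.eq_lincomb hP hK
  rw [hya, hyb] at hy1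
  rw [hza, hzb] at hz1
  have hy2 := (h1.lincomb hP h2 1 (0 - c * lam / (c ^ 2 - 1) * 1)).2
  have hz2 := (h1.lincomb hP h2 0 (1 - c * lam / (c ^ 2 - 1) * 0)).2
  rw [← hy1] at hy2
  rw [← hz1] at hz2
  have a1 := congrFun hy1 T
  have a2 := congrFun hz1 T
  have a3 := congrFun hy2 T
  have a4 := congrFun hz2 T
  rw [evans, monodromy, hw, hv, hw', hv', a1, a2, a3, a4, hillDiscriminant, hillMonodromy,
    Matrix.trace_fin_two_of, Matrix.det_fin_two]
  rw [hillMonodromy, Matrix.det_fin_two_of] at hdet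
  simp
  linear_combination Complex.exp (c * lam / (c ^ 2 - 1) * T) ^ 2 * hdet

/-- This computes `D_{λλ}(0, 1)`, with `κ = c T / (c² - 1)` and `τ = 1 / (c² - 1)²`. -/
theorem iteratedDeriv_two_exp_discriminant {D : ℂ → ℂ} (hD : Differentiable ℂ D) (hD0 : D 0 = 2)
    (κ τ : ℂ) :
    iteratedDeriv 2 (fun l => Complex.exp (κ * l) ^ 2 - Complex.exp (κ * l) * D (τ * l ^ 2) + 1) 0
      = 2 * (κ ^ 2 - τ * deriv D 0) := by
  have hexp : ∀ l : ℂ, HasDerivAt (fun l => Complex.exp (κ * l)) (κ * Complex.exp (κ * l)) l :=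
    fun l => (((hasDerivAt_id l).const_mul κ).cexp).congr_deriv (by simp [mul_comm])
  have hsq : ∀ l : ℂ, HasDerivAt (fun l => τ * l ^ 2) (2 * τ * l) l :=
    fun l => (((hasDerivAt_id l).pow 2).const_mul τ).congr_deriv (by simp; ring)
  have hcomp : ∀ l : ℂ, HasDerivAt (fun l => D (τ * l ^ 2)) (deriv D (τ * l ^ 2) * (2 * τ * l)) l :=
    fun l => (hD _).hasDerivAt.comp l (hsq l)
  have hcomp' : ∀ l : ℂ, HasDerivAt (fun l => deriv D (τ * l ^ 2))
      (deriv (deriv D) (τ * l ^ 2) * (2 * τ * l)) l :=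
    fun l => ((hD.contDiff (n := 2)).differentiable_deriv_two _).hasDerivAt.comp l (hsq l)
  have h1 : deriv (fun l => Complex.exp (κ * l) ^ 2 - Complex.exp (κ * l) * D (τ * l ^ 2) + 1)
      = fun l => 2 * κ * Complex.exp (κ * l) ^ 2 - (κ * Complex.exp (κ * l) * D (τ * l ^ 2)
        + Complex.exp (κ * l) * (deriv D (τ * l ^ 2) * (2 * τ * l))) := by
    funext l
    refine ((((hexp l).pow 2).sub ((hexp l).mul (hcomp l))).add_const 1).deriv.trans ?_
    simp; ring
  rw [iteratedDeriv_succ, iteratedDeriv_one, h1]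
  refine ((((hexp 0).pow 2).const_mul (2 * κ)).sub ((((hexp 0).const_mul κ).mul (hcomp 0)).add
    ((hexp 0).mul ((hcomp' 0).mul ((hasDerivAt_id (0 : ℂ)).const_mul (2 * τ)))))).deriv.trans ?_
  simp [hD0]; ring

/-- For `c² > 1` the index condition says `0 < Δ'(0) < c² T²`. -/
theorem deriv_hillDiscriminant_mem (hV : ContDiff ℝ 2 V) (hc : 0 < c ^ 2 - 1)
    (hf : IsPeriodicTravelingWave V c T f)
    (hindex : modulationalIndex V c T f * parityIndex V c T f = 1) :
    0 < (deriv (hillDiscriminant (hillPotential V c f) T) 0).re ∧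
      (deriv (hillDiscriminant (hillPotential V c f) T) 0).re < (c * T) ^ 2 := by
  have hP := continuous_hillPotential (c := c) hV hf.contDiff.continuous
  obtain ⟨K, hK⟩ := hf.exists_hillPotential_bound hV hc.ne'
  have hD := differentiable_hillDiscriminant hP hK hf.period_pos.le
  have hD0 := hillDiscriminant_eq_two_of_periodic (T := T) hP hK (hf.isHillSol hV hc.ne')
    hf.deriv_ne_zero (fun t => by simp [hf.fundamental_period.1.2 t])
  have hcC : (c : ℂ) ^ 2 - 1 ≠ 0 := by exact_mod_cast hc.ne'
  have hE : (fun lam : ℂ => evans V c T f lam 1) = fun l =>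
      Complex.exp (((c * T / (c ^ 2 - 1) : ℝ) : ℂ) * l) ^ 2
        - Complex.exp (((c * T / (c ^ 2 - 1) : ℝ) : ℂ) * l)
          * hillDiscriminant (hillPotential V c f) T (((1 / (c ^ 2 - 1) ^ 2 : ℝ) : ℂ) * l ^ 2)
        + 1 := by
    funext l
    rw [evans_one_eq hV hc.ne' hf]
    push_cast
    have e1 : (c : ℂ) * l / (c ^ 2 - 1) * T = c * T / (c ^ 2 - 1) * l := by ring
    have e2 : (l / ((c : ℂ) ^ 2 - 1)) ^ 2 = 1 / (c ^ 2 - 1) ^ 2 * l ^ 2 := by field_simp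
    rw [e1, e2]
  rw [modulationalIndex, parityIndex, hE, iteratedDeriv_two_exp_discriminant hD hD0] at hindex
  set a := (deriv (hillDiscriminant (hillPotential V c f) T) 0).re
  have hre : (2 * (((c * T / (c ^ 2 - 1) : ℝ) : ℂ) ^ 2 - ((1 / (c ^ 2 - 1) ^ 2 : ℝ) : ℂ)
      * deriv (hillDiscriminant (hillPotential V c f) T) 0)).re
      = 2 / (c ^ 2 - 1) ^ 2 * ((c * T) ^ 2 - a) := by
    rw [← Complex.ofReal_pow, ← Complex.ofReal_ofNat, Complex.re_ofReal_mul, Complex.sub_re,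
      Complex.re_ofReal_mul, Complex.ofReal_re]
    change 2 * ((c * T / (c ^ 2 - 1)) ^ 2 - 1 / (c ^ 2 - 1) ^ 2 * a) = _
    rw [div_pow]; ring
  rw [hre, ← mul_assoc] at hindex
  have hpos : 0 < (c ^ 2 - 1) * (2 / (c ^ 2 - 1) ^ 2) := by positivity
  rw [sign_mul, sign_pos hpos, one_mul] at hindex
  -- The index is now the sign of `a ((c T)² - a)`. A negative `a` makes the second factor positive,
  -- so a positive product forces both factors to be positive.
  rcases lt_trichotomy a 0 with h | h | h
  · rw [sign_neg h, sign_pos (by nlinarith [sq_nonneg (c * T)])] at hindex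
    exact absurd hindex (by decide)
  · rw [h, sign_zero] at hindex
    exact absurd hindex (by simp)
  · rw [sign_pos h, one_mul, sign_eq_one_iff] at hindex
    exact ⟨h, by linarith⟩

/-- The dispersion relation produces points of the Floquet spectrum. -/
theorem mem_floquetSpectrum (hV : ContDiff ℝ 2 V) (hc : c ^ 2 - 1 ≠ 0)
    (hf : IsPeriodicTravelingWave V c T f) {z : ℂ} {θ : ℝ}
    (h : 2 * Complex.cos ((c * T : ℝ) * z - θ)
      = hillDiscriminant (hillPotential V c f) T (-z ^ 2)) :
    ((c : ℂ) ^ 2 - 1) * (Complex.I * z) ∈ floquetSpectrum V c f := by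
  have hP := continuous_hillPotential (c := c) hV hf.contDiff.continuous
  obtain ⟨K, hK⟩ := hf.exists_hillPotential_bound hV hc
  have hcC : (c : ℂ) ^ 2 - 1 ≠ 0 := by exact_mod_cast hc
  set lam := ((c : ℂ) ^ 2 - 1) * (Complex.I * z) with hlam
  have hν : -z ^ 2 = (lam / (c ^ 2 - 1)) ^ 2 := by
    rw [hlam, mul_div_cancel_left₀ _ hcC, mul_pow, Complex.I_sq]; ring
  have hb : (c : ℂ) * lam / (c ^ 2 - 1) = c * (Complex.I * z) := by
    rw [hlam]; field_simp
  clear_value lam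
  -- The Hill multiplier `exp (-iφ)` times the gauge factor `exp (i c T z)` is `exp (iθ)`, so `w`
  -- has periodic modulus.
  set φ : ℂ := (c * T : ℝ) * z - θ with hφ
  have hμ : Complex.exp (-φ * Complex.I) ^ 2
      - hillDiscriminant (hillPotential V c f) T ((lam / (c ^ 2 - 1)) ^ 2)
        * Complex.exp (-φ * Complex.I) + 1 = 0 := by
    rw [← hν, ← h, Complex.two_cos]
    have h1 : Complex.exp (φ * Complex.I) * Complex.exp (-φ * Complex.I) = 1 := by
      rw [← Complex.exp_add]; simp
    linear_combination -h1
  obtain ⟨y, hy, hy0, hyT⟩ := exists_floquet_solution hP hK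
    (hf.periodic_hillPotential hV hc) hμ
  obtain ⟨hw, -⟩ := hy.isLinearizedSol hc
  refine ⟨_, hw, fun h0 => hy0 (funext fun t => ?_), ?_⟩
  · have := congrFun h0 t
    simpa [Complex.exp_ne_zero] using this
  · have hper : Function.Periodic
        (fun t : ℝ => ‖Complex.exp (c * lam / (c ^ 2 - 1) * t) * y t‖) T := by
      intro t
      have e : Complex.exp (c * lam / (c ^ 2 - 1) * (t + T : ℝ)) * y (t + T)
          = Complex.exp (θ * Complex.I)
            * (Complex.exp (c * lam / (c ^ 2 - 1) * t) * y t) := by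
        rw [hyT, hb, ← mul_assoc (Complex.exp _) (Complex.exp _),
          ← mul_assoc (Complex.exp _) (Complex.exp _), ← Complex.exp_add, ← Complex.exp_add, hφ]
        congr 2
        push_cast; ring
      simp only [e]
      rw [norm_mul, Complex.norm_exp_ofReal_mul_I, one_mul]
    obtain ⟨B, hB⟩ := (hper.isBounded_of_continuous hf.period_pos.ne'
      hw.1.continuous.norm).exists_norm_le
    exact ⟨B, fun t => by simpa using hB _ ⟨t, rfl⟩⟩

end Wave


/-! ### Level curves of unimodular holomorphic functions -/

section ComplexAnalysis

open Filter

/-- A holomorphic function that is unimodular on the real line and has a critical point there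
is unimodular at nonreal points arbitrarily close to the critical point. -/
theorem exists_nonreal_norm_eq_one {Z : ℂ → ℂ} {x : ℝ} (hZ : AnalyticAt ℂ Z x)
    (hnorm : ∀ᶠ t : ℝ in 𝓝 x, ‖Z t‖ = 1) (hd : deriv Z x = 0) {U : Set ℂ} (hU : U ∈ 𝓝 (x : ℂ)) :
    ∃ z ∈ U, z.im ≠ 0 ∧ ‖Z z‖ = 1 := by
  have hZ0 : ‖Z x‖ = 1 := hnorm.self_of_nhds
  have hh : AnalyticAt ℂ (fun z => Z z - Z x) x := hZ.sub analyticAt_const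
  -- If `Z` is locally constant, any nearby point above `x` will do. Otherwise `Z - Z x` vanishes to
  -- an order `m ≥ 2`.
  by_cases hev : ∀ᶠ z in 𝓝 (x : ℂ), Z z - Z x = 0
  · have hline : Tendsto (fun r : ℝ => (x : ℂ) + r * Complex.I) (𝓝[>] 0) (𝓝 x) := by
      have : Continuous fun r : ℝ => (x : ℂ) + r * Complex.I := by fun_prop
      simpa using (this.tendsto 0).mono_left nhdsWithin_le_nhds
    obtain ⟨r, ⟨hr1, hr2⟩, hr0⟩ := ((hline.eventually (hev.and hU)).and
      self_mem_nhdsWithin).exists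
    refine ⟨_, hr2, ?_, by rw [sub_eq_zero.1 hr1, hZ0]⟩
    simpa using (ne_of_gt hr0 : r ≠ 0)
  obtain ⟨m, u, hu, hu0, hfac⟩ := hh.exists_eventuallyEq_pow_smul_nonzero_iff.2 hev
  simp only [smul_eq_mul] at hfac
  have hm0 : m ≠ 0 := by
    rintro rfl
    have := hfac.self_of_nhds
    simp at this
    exact hu0 this.symm
  have hm1 : m ≠ 1 := by
    rintro rfl
    have h1 : HasDerivAt (fun z => Z z - Z x) (u x) (x : ℂ) := by
      have h2 : HasDerivAt (fun z : ℂ => (z - x) ^ 1 * u z) (u x) (x : ℂ) := by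
        refine ((((hasDerivAt_id (x : ℂ)).sub_const (x : ℂ)).pow 1).mul
          hu.differentiableAt.hasDerivAt).congr_deriv ?_
        simp
      exact h2.congr_of_eventuallyEq hfac
    have h3 := (hZ.differentiableAt.hasDerivAt.sub_const (Z x)).unique h1
    exact hu0 (by rw [← h3, hd])
  have hm2 : 2 ≤ m := by omega
  have hmpos : (0 : ℝ) < m := by positivity
  set pt : ℝ → ℝ → ℂ := fun t r => x + r * Complex.exp (t * Complex.I) with hpt
  set b : ℂ := (starRingEnd ℂ) (Z x) * u x with hb
  have hb0 : b ≠ 0 := mul_ne_zero (by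
    rw [Ne, map_eq_zero, ← norm_eq_zero, hZ0]; exact one_ne_zero) hu0
  -- On the circle of radius `r`, `‖Z‖² - 1 = r ^ m * Q t r`, and `Q t r` tends to `2 Re (b exp (i m
  -- t))` as `r → 0`.
  set Q : ℝ → ℝ → ℝ := fun t r =>
    2 * ((starRingEnd ℂ) (Z x) * Complex.exp (t * Complex.I) ^ m * u (pt t r)).re
      + r ^ m * ‖u (pt t r)‖ ^ 2 with hQ
  have hptlim : ∀ t, Tendsto (pt t) (𝓝[>] 0) (𝓝 (x : ℂ)) := fun t => by
    have : Continuous (pt t) := by fun_prop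
    simpa [hpt] using (this.tendsto 0).mono_left nhdsWithin_le_nhds
  have hQlim : ∀ t, Tendsto (Q t) (𝓝[>] 0) (𝓝 (2 * (b * Complex.exp (t * Complex.I) ^ m).re)) := by
    intro t
    have h1 : Tendsto (fun r => u (pt t r)) (𝓝[>] 0) (𝓝 (u x)) :=
      hu.continuousAt.tendsto.comp (hptlim t)
    have h2 : Tendsto (fun r : ℝ => r ^ m) (𝓝[>] 0) (𝓝 0) := by
      have := (continuous_pow (M := ℝ) m).tendsto 0
      simpa [hm0] using this.mono_left nhdsWithin_le_nhds
    have h3 := (((Complex.continuous_re.tendsto _).comp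
      (h1.const_mul ((starRingEnd ℂ) (Z x) * Complex.exp (t * Complex.I) ^ m))).const_mul 2).add
      (h2.mul (h1.norm.pow 2))
    have h4 : 2 * (b * Complex.exp (t * Complex.I) ^ m).re
        = 2 * ((starRingEnd ℂ) (Z x) * Complex.exp (t * Complex.I) ^ m * u x).re
          + 0 * ‖u x‖ ^ 2 := by
      rw [zero_mul, add_zero, hb, mul_right_comm]
    rw [h4]
    exact h3
  have hQeq : ∀ t r : ℝ, Z (pt t r) - Z x = (pt t r - x) ^ m * u (pt t r) →
      ‖Z (pt t r)‖ ^ 2 - 1 = r ^ m * Q t r := by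
    intro t r h
    have h1 : Z (pt t r) = Z x + (r : ℂ) ^ m * (Complex.exp (t * Complex.I) ^ m * u (pt t r)) := by
      rw [eq_add_of_sub_eq h, hpt]; ring
    have h2 : ‖Complex.exp (t * Complex.I) ^ m * u (pt t r)‖ = ‖u (pt t r)‖ := by
      rw [norm_mul, norm_pow, Complex.norm_exp_ofReal_mul_I, one_pow, one_mul]
    have hZ1 : Complex.normSq (Z x) = 1 := by rw [Complex.normSq_eq_norm_sq, hZ0, one_pow]
    have h3 : Complex.normSq (Complex.exp (t * Complex.I) ^ m * u (pt t r)) = ‖u (pt t r)‖ ^ 2 := by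
      rw [Complex.normSq_eq_norm_sq, h2]
    rw [h1, ← Complex.normSq_eq_norm_sq, ← Complex.ofReal_pow]
    simp only [hQ]
    rw [← h3, mul_assoc ((starRingEnd ℂ) (Z x))]
    generalize Complex.exp (t * Complex.I) ^ m * u (pt t r) = e
    rw [Complex.normSq_apply] at hZ1 ⊢
    rw [Complex.normSq_apply, Complex.add_re, Complex.add_im, Complex.re_ofReal_mul,
      Complex.im_ofReal_mul, Complex.mul_re, Complex.conj_re, Complex.conj_im]
    linear_combination hZ1
  -- Along the real axis, `t = 0`, `Q` vanishes identically; hence its limit `2 Re b` is 0 and the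
  -- angular profile is a pure sine.
  have hbre : b.re = 0 := by
    have hzero : ∀ᶠ r in 𝓝[>] (0 : ℝ), Q 0 r = 0 := by
      have hline : Tendsto (fun r : ℝ => x + r) (𝓝[>] 0) (𝓝 x) := by
        have : Continuous fun r : ℝ => x + r := by fun_prop
        simpa using (this.tendsto 0).mono_left nhdsWithin_le_nhds
      filter_upwards [hline.eventually hnorm, (hptlim 0).eventually hfac, self_mem_nhdsWithin]
        with r h1 h2 h3
      have h4 := hQeq 0 r h2
      have h5 : pt 0 r = ((x + r : ℝ) : ℂ) := by simp [hpt]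
      rw [h5, h1] at h4
      have h6 : r ^ m ≠ 0 := pow_ne_zero _ (ne_of_gt h3)
      have h7 : r ^ m * Q 0 r = 0 := by linarith
      exact (mul_eq_zero.1 h7).resolve_left h6
    have := tendsto_nhds_unique (hQlim 0)
      ((tendsto_const_nhds (x := (0 : ℝ))).congr' (hzero.mono fun r h => h.symm))
    simpa using this
  have hbim : b.im ≠ 0 := fun h => hb0 (Complex.ext hbre h)
  have hval : ∀ t : ℝ, 2 * (b * Complex.exp (t * Complex.I) ^ m).re
      = -(2 * b.im * Real.sin (m * t)) := by
    intro t
    have : Complex.exp (t * Complex.I) ^ m = Complex.exp ((m * t : ℝ) * Complex.I) := by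
      rw [← Complex.exp_nat_mul]; congr 1; push_cast; ring
    rw [this, Complex.mul_re, hbre, Complex.exp_ofReal_mul_I_im]
    ring
  -- Consecutive extrema of `sin (m t)`, of opposite sign. Both angles lie in `(0, π)` because `m ≥
  -- 2`, so the zero between them is off the real axis.
  set t₁ : ℝ := Real.pi / (2 * m) with ht₁
  set t₂ : ℝ := 3 * Real.pi / (2 * m) with ht₂
  have hs1 : Real.sin (m * t₁) = 1 := by
    rw [ht₁, show (m : ℝ) * (Real.pi / (2 * m)) = Real.pi / 2 by field_simp, Real.sin_pi_div_two]
  have hs2 : Real.sin (m * t₂) = -1 := by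
    rw [ht₂, show (m : ℝ) * (3 * Real.pi / (2 * m)) = Real.pi / 2 + Real.pi by field_simp; ring,
      Real.sin_add_pi, Real.sin_pi_div_two]
  have hprod : ∀ᶠ r in 𝓝[>] (0 : ℝ), Q t₁ r * Q t₂ r < 0 := by
    refine ((hQlim t₁).mul (hQlim t₂)).eventually_lt_const ?_
    rw [hval, hval, hs1, hs2]
    have : 0 < b.im ^ 2 := by positivity
    nlinarith
  obtain ⟨ε, hε, hball⟩ := Metric.mem_nhds_iff.1
    (Filter.inter_mem hU (hZ.eventually_analyticAt.and hfac))
  have hpi := Real.pi_pos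
  obtain ⟨r, ⟨hr, hr0, hrε⟩⟩ := (hprod.and (Ioo_mem_nhdsGT hε)).exists
  have hmem : ∀ t, pt t r ∈ Metric.ball (x : ℂ) ε := by
    intro t
    rw [Metric.mem_ball, dist_eq_norm]
    simp only [hpt, add_sub_cancel_left]
    rw [norm_mul, Complex.norm_exp_ofReal_mul_I, mul_one, Complex.norm_real, Real.norm_eq_abs,
      abs_of_pos hr0]
    exact hrε
  have hcont : Continuous fun t => ‖Z (pt t r)‖ ^ 2 - 1 := by
    have h1 : Continuous fun t => pt t r := by fun_prop
    have h2 : Continuous fun t => Z (pt t r) := continuous_iff_continuousAt.2 fun t =>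
      ((hball (hmem t)).2.1.continuousAt).comp (f := fun t => pt t r) h1.continuousAt
    exact (h2.norm.pow 2).sub continuous_const
  have hsign : (‖Z (pt t₁ r)‖ ^ 2 - 1) * (‖Z (pt t₂ r)‖ ^ 2 - 1) < 0 := by
    rw [hQeq _ _ (hball (hmem t₁)).2.2, hQeq _ _ (hball (hmem t₂)).2.2]
    have : 0 < r ^ m * r ^ m := by positivity
    nlinarith
  have ht12 : t₁ ≤ t₂ := by rw [ht₁, ht₂]; gcongr; linarith
  obtain ⟨t, ht, ht0⟩ := intermediate_value_uIcc (a := t₁) (b := t₂) hcont.continuousOn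
    (show (0 : ℝ) ∈ _ by
      rw [Set.mem_uIcc]
      rcases mul_neg_iff.1 hsign with h | h
      · exact Or.inr ⟨h.2.le, h.1.le⟩
      · exact Or.inl ⟨h.1.le, h.2.le⟩)
  rw [Set.uIcc_of_le ht12] at ht
  have htpos : 0 < t := lt_of_lt_of_le (by rw [ht₁]; positivity) ht.1
  have htpi : t < Real.pi := by
    refine lt_of_le_of_lt ht.2 ?_
    rw [ht₂, div_lt_iff₀ (by positivity)]
    have : (2 : ℝ) ≤ m := by exact_mod_cast hm2
    nlinarith
  refine ⟨pt t r, (hball (hmem t)).1, ?_, ?_⟩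
  · have : (pt t r).im = r * Real.sin t := by
      simp only [hpt, Complex.add_im, Complex.ofReal_im, zero_add, Complex.im_ofReal_mul,
        Complex.exp_ofReal_mul_I_im]
    rw [this]
    exact (mul_pos hr0 (Real.sin_pos_of_pos_of_lt_pi htpos htpi)).ne'
  · have h1 : ‖Z (pt t r)‖ ^ 2 = 1 := by linarith
    exact (pow_eq_one_iff_of_nonneg (norm_nonneg _) two_ne_zero).1 h1

/-- A holomorphic function that is nonnegative on the real line has a holomorphic square root. -/
theorem exists_analyticAt_sqrt {h : ℂ → ℂ} {x : ℝ} (hh : AnalyticAt ℂ h x)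
    (hreal : ∀ᶠ t : ℝ in 𝓝 x, (h t).im = 0 ∧ 0 ≤ (h t).re)
    (hne : ¬∀ᶠ z in 𝓝 (x : ℂ), h z = 0) :
    ∃ q : ℂ → ℂ, AnalyticAt ℂ q x ∧ ∀ᶠ z in 𝓝 (x : ℂ), q z ^ 2 = h z := by
  obtain ⟨n, u, hu, hu0, hfac⟩ := hh.exists_eventuallyEq_pow_smul_nonzero_iff.2 hne
  simp only [smul_eq_mul] at hfac
  have hcoe : Tendsto (fun t : ℝ => (t : ℂ)) (𝓝 x) (𝓝 (x : ℂ)) :=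
    Complex.continuous_ofReal.tendsto x
  have hfacR : ∀ᶠ t : ℝ in 𝓝 x, (h t).im = (t - x) ^ n * (u t).im ∧
      (h t).re = (t - x) ^ n * (u t).re := by
    filter_upwards [hcoe.eventually hfac] with t ht
    rw [ht, ← Complex.ofReal_sub, ← Complex.ofReal_pow]
    exact ⟨Complex.im_ofReal_mul _ _, Complex.re_ofReal_mul _ _⟩
  have hulim : Tendsto (fun t : ℝ => u t) (𝓝 x) (𝓝 (u x)) := hu.continuousAt.tendsto.comp hcoe
  -- To the right of `x` the factor `(t - x) ^ n` is positive, so `u` inherits reality and sign from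
  -- `h`; in the limit `u x > 0`.
  have hright : ∀ᶠ t : ℝ in 𝓝[>] x, (u t).im = 0 ∧ 0 ≤ (u t).re := by
    filter_upwards [nhdsWithin_le_nhds hfacR, nhdsWithin_le_nhds hreal, self_mem_nhdsWithin]
      with t h1 h2 h3
    have hpos : 0 < (t - x) ^ n := pow_pos (sub_pos.2 h3) n
    refine ⟨(mul_eq_zero.1 (h1.1.symm.trans h2.1)).resolve_left hpos.ne', ?_⟩
    exact nonneg_of_mul_nonneg_right (h1.2 ▸ h2.2) hpos
  have him : (u x).im = 0 := tendsto_nhds_unique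
    (((Complex.continuous_im.tendsto _).comp hulim).mono_left nhdsWithin_le_nhds)
    (tendsto_const_nhds.congr' (hright.mono fun t h => h.1.symm))
  have hre : 0 < (u x).re := by
    refine lt_of_le_of_ne (ge_of_tendsto (((Complex.continuous_re.tendsto _).comp hulim).mono_left
      nhdsWithin_le_nhds) (hright.mono fun t h => h.2)) fun h0 => hu0 (Complex.ext h0.symm him)
  -- A zero of odd order would make `h` negative to the left of `x`.
  have heven : Even n := by
    by_contra hodd
    rw [Nat.not_even_iff_odd] at hodd
    have hupos : ∀ᶠ t : ℝ in 𝓝 x, 0 < (u t).re :=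
      ((Complex.continuous_re.tendsto _).comp hulim).eventually_const_lt hre
    obtain ⟨t, ⟨h1, h2, h3⟩, h4⟩ := (((hfacR.and (hreal.and hupos)).filter_mono
      nhdsWithin_le_nhds).and (self_mem_nhdsWithin (s := Set.Iio x))).exists
    have : (t - x) ^ n < 0 := hodd.pow_neg (sub_neg.2 h4)
    nlinarith [h1.2, h2.2]
  obtain ⟨j, rfl⟩ := heven
  refine ⟨fun z => (z - x) ^ j * Complex.exp (Complex.log (u z) / 2), ?_, ?_⟩
  · have := hu.clog (Complex.mem_slitPlane_iff.2 (Or.inl hre))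
    fun_prop
  · filter_upwards [hfac, hu.continuousAt.eventually_ne hu0] with z h1 h2
    rw [h1, mul_pow, ← Complex.exp_nat_mul]
    have : ((2 : ℕ) : ℂ) * (Complex.log (u z) / 2) = Complex.log (u z) := by push_cast; ring
    rw [this, Complex.exp_log h2]
    ring

/-- The hypothesis on `deriv F x` says that `Z = exp (i p) F` is critical at `x`. At a nonreal point
with `‖Z‖ = 1`, taking `θ = arg Z` gives `exp (-i (p - θ)) = F` and `exp (i (p - θ)) = E`. -/
theorem exists_nonreal_dispersion_of_factors {E F p : ℂ → ℂ} {x : ℝ} (hF : AnalyticAt ℂ F x)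
    (hp : AnalyticAt ℂ p x) (hEF : ∀ᶠ z in 𝓝 (x : ℂ), E z * F z = 1)
    (hFR : ∀ᶠ t : ℝ in 𝓝 x, ‖F t‖ = 1) (hpR : ∀ᶠ t : ℝ in 𝓝 x, (p t).im = 0)
    (hd : deriv F x = -(Complex.I * deriv p x * F x)) {U : Set ℂ} (hU : U ∈ 𝓝 (x : ℂ)) :
    ∃ z ∈ U, z.im ≠ 0 ∧ ∃ θ : ℝ, 2 * Complex.cos (p z - θ) = E z + F z := by
  have hZ : AnalyticAt ℂ (fun z => Complex.exp (p z * Complex.I) * F z) x := by fun_prop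
  obtain ⟨z, ⟨hzU, hzEF⟩, hzim, hzn⟩ := exists_nonreal_norm_eq_one hZ (by
      filter_upwards [hFR, hpR] with t h1 h2
      have : p t = ((p t).re : ℂ) := Complex.ext rfl h2
      rw [norm_mul, h1, this, Complex.norm_exp_ofReal_mul_I, one_mul]) (by
      have h1 := hp.differentiableAt.hasDerivAt.mul_const Complex.I
      have h2 := h1.cexp.mul hF.differentiableAt.hasDerivAt
      refine h2.deriv.trans ?_
      rw [hd]; ring) (Filter.inter_mem hU hEF)
  refine ⟨z, hzU, hzim, Complex.arg (Complex.exp (p z * Complex.I) * F z), ?_⟩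
  have harg := Complex.norm_mul_exp_arg_mul_I (Complex.exp (p z * Complex.I) * F z)
  set θ := Complex.arg (Complex.exp (p z * Complex.I) * F z)
  rw [hzn, Complex.ofReal_one, one_mul] at harg
  have h1 : Complex.exp (p z * Complex.I) * Complex.exp (-(p z * Complex.I)) = 1 := by
    rw [← Complex.exp_add]; simp
  have h2 : Complex.exp (θ * Complex.I) * Complex.exp (-(θ * Complex.I)) = 1 := by
    rw [← Complex.exp_add]; simp
  have hF1 : Complex.exp (-(p z - θ) * Complex.I) = F z := by
    rw [show -(p z - (θ : ℂ)) * Complex.I = -(p z * Complex.I) + θ * Complex.I by ring,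
      Complex.exp_add, harg]
    linear_combination F z * h1
  have h3 : Complex.exp ((p z - θ) * Complex.I) * Complex.exp (-(p z - θ) * Complex.I) = 1 := by
    rw [← Complex.exp_add, ← add_mul, add_neg_cancel, zero_mul, Complex.exp_zero]
  rw [hF1] at h3
  have hF0 : F z ≠ 0 := right_ne_zero_of_mul_eq_one h3
  have hE1 : Complex.exp ((p z - θ) * Complex.I) = E z :=
    mul_right_cancel₀ hF0 (h3.trans (Eq.symm hzEF))
  rw [Complex.two_cos, hF1, hE1]

/-- Nonreal solutions of `2 cos (p z - θ) = g z`, `θ ∈ ℝ`, near a point at which the phase velocity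
of `arccos (g / 2)` is that of `p`, up to sign. -/
theorem exists_nonreal_dispersion {g p : ℂ → ℂ} {x : ℝ} (hg : AnalyticAt ℂ g x)
    (hp : AnalyticAt ℂ p x) (hgR : ∀ᶠ t : ℝ in 𝓝 x, (g t).im = 0 ∧ (g t).re ^ 2 ≤ 4)
    (hpR : ∀ᶠ t : ℝ in 𝓝 x, (p t).im = 0) (hne : ¬∀ᶠ z in 𝓝 (x : ℂ), 4 - g z ^ 2 = 0) :
    ∃ L : ℂ, Tendsto (fun z => deriv g z ^ 2 / (4 - g z ^ 2)) (𝓝[≠] (x : ℂ)) (𝓝 L) ∧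
      (deriv p x ^ 2 = L → ∀ U ∈ 𝓝 (x : ℂ), ∃ z ∈ U, z.im ≠ 0 ∧
        ∃ θ : ℝ, 2 * Complex.cos (p z - θ) = g z) := by
  have hh : AnalyticAt ℂ (fun z => 4 - g z ^ 2) x := by fun_prop
  have hhR : ∀ᶠ t : ℝ in 𝓝 x, (4 - g t ^ 2).im = 0 ∧ (4 - g t ^ 2).re = 4 - (g t).re ^ 2 := by
    filter_upwards [hgR] with t ht
    have : g t = ((g t).re : ℂ) := Complex.ext rfl ht.1
    have h4 : 4 - g t ^ 2 = ((4 - (g t).re ^ 2 : ℝ) : ℂ) := by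
      conv_lhs => rw [this]
      push_cast; rfl
    rw [h4]
    exact ⟨Complex.ofReal_im _, Complex.ofReal_re _⟩
  obtain ⟨q, hq, hq2⟩ := exists_analyticAt_sqrt hh (by
    filter_upwards [hgR, hhR] with t h1 h2
    exact ⟨h2.1, by rw [h2.2]; linarith [h1.2]⟩) hne
  have hcoe : Tendsto (fun t : ℝ => (t : ℂ)) (𝓝 x) (𝓝 (x : ℂ)) :=
    Complex.continuous_ofReal.tendsto x
  have hqR : ∀ᶠ t : ℝ in 𝓝 x, (q t).im = 0 ∧ (q t).re ^ 2 = 4 - (g t).re ^ 2 := by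
    filter_upwards [hgR, hhR, hcoe.eventually hq2] with t h1 h2 h3
    rw [← h3, pow_two, Complex.mul_im, Complex.mul_re] at h2
    have him : (q t).im = 0 := by
      by_contra h
      have h4 : (q t).re = 0 := by
        have : (q t).re * (q t).im = 0 := by linarith [h2.1]
        exact (mul_eq_zero.1 this).resolve_right h
      have : 0 < (q t).im ^ 2 := by positivity
      have h5 := h2.2
      rw [h4] at h5
      nlinarith [h1.2]
    refine ⟨him, ?_⟩
    have := h2.2
    rw [him] at this
    linarith
  set E : ℂ → ℂ := fun z => (g z + Complex.I * q z) / 2 with hE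
  set F : ℂ → ℂ := fun z => (g z - Complex.I * q z) / 2 with hF
  have hEa : AnalyticAt ℂ E x := by fun_prop
  have hFa : AnalyticAt ℂ F x := by fun_prop
  have hEF : ∀ᶠ z in 𝓝 (x : ℂ), E z * F z = 1 := by
    filter_upwards [hq2] with z hz
    simp only [hE, hF]
    linear_combination hz / 4 - q z ^ 2 / 4 * Complex.I_sq
  have hEFsum : ∀ z, E z + F z = g z := fun z => by simp only [hE, hF]; ring
  have hnorm : ∀ᶠ t : ℝ in 𝓝 x, ‖E t‖ = 1 ∧ ‖F t‖ = 1 := by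
    filter_upwards [hgR, hqR] with t h1 h2
    have e1 : Complex.normSq (E t) = 1 := by
      simp [hE, Complex.normSq_apply, h1.1, h2.1]; linarith [h2.2]
    have e2 : Complex.normSq (F t) = 1 := by
      simp [hF, Complex.normSq_apply, h1.1, h2.1]; linarith [h2.2]
    rw [Complex.normSq_eq_norm_sq] at e1 e2
    exact ⟨(pow_eq_one_iff_of_nonneg (norm_nonneg _) two_ne_zero).1 e1,
      (pow_eq_one_iff_of_nonneg (norm_nonneg _) two_ne_zero).1 e2⟩
  -- Writing `E = exp (iφ)`, this is the phase velocity `φ'`. Since `ψ q = -g'`, it continues `g'² /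
  -- (4 - g²) = ψ²` across the zeros of `4 - g²`.
  set ψ : ℂ → ℂ := fun z => -Complex.I * deriv E z * F z with hψ
  have hψa : AnalyticAt ℂ ψ x := by
    have := hEa.deriv
    fun_prop
  have hψq : ∀ᶠ z in 𝓝 (x : ℂ), ψ z * q z = -deriv g z := by
    filter_upwards [hq2.eventually_nhds, hEF, hg.eventually_analyticAt, hq.eventually_analyticAt]
      with z h1 h2 h3 h4
    have d1 : HasDerivAt E ((deriv g z + Complex.I * deriv q z) / 2) z :=
      ((h3.differentiableAt.hasDerivAt).add
        ((h4.differentiableAt.hasDerivAt).const_mul Complex.I)).div_const 2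
    have d2 : 2 * q z * deriv q z = -(2 * g z * deriv g z) := by
      have a1 : HasDerivAt (fun z => q z ^ 2) (2 * q z * deriv q z) z := 
        (h4.differentiableAt.hasDerivAt.pow 2).congr_deriv (by simp)
      have a2 : HasDerivAt (fun z => 4 - g z ^ 2) (-(2 * g z * deriv g z)) z := 
        ((h3.differentiableAt.hasDerivAt.pow 2).const_sub 4).congr_deriv (by simp)
      exact a1.unique (a2.congr_of_eventuallyEq h1)
    have d3 : deriv E z * q z = -Complex.I * deriv g z * E z := by
      rw [d1.deriv]
      simp only [hE]
      linear_combination Complex.I / 4 * d2 + q z * deriv g z / 2 * Complex.I_sq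
    simp only [hψ]
    linear_combination -Complex.I * F z * d3 + Complex.I ^ 2 * deriv g z * h2
      + deriv g z * Complex.I_sq
  refine ⟨ψ x ^ 2, ?_, fun hL U hU => ?_⟩
  · refine ((hψa.continuousAt.tendsto.pow 2).mono_left nhdsWithin_le_nhds).congr' ?_
    filter_upwards [nhdsWithin_le_nhds hψq, nhdsWithin_le_nhds hq2,
      hh.eventually_eq_zero_or_eventually_ne_zero.resolve_left hne] with z h1 h2 h3
    rw [eq_div_iff h3]
    linear_combination (ψ z * q z - deriv g z) * h1 - ψ z ^ 2 * h2
  · have hder : deriv E x * F x + E x * deriv F x = 0 :=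
      (hEa.differentiableAt.hasDerivAt.mul hFa.differentiableAt.hasDerivAt).unique
        ((hasDerivAt_const (x : ℂ) (1 : ℂ)).congr_of_eventuallyEq hEF)
    have h1 := hEF.self_of_nhds
    -- If `p' = ψ` then `exp (i p) F` is critical; if `p' = -ψ` then `exp (i p) E` is.
    rcases sq_eq_sq_iff_eq_or_eq_neg.1 hL with h | h
    · obtain ⟨z, hz, hzi, θ, hθ⟩ := exists_nonreal_dispersion_of_factors (E := E) hFa hp hEF
        (hnorm.mono fun t h => h.2) hpR (by
          rw [h]; simp only [hψ]
          linear_combination F x * hder - deriv F x * h1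
            - deriv E x * F x ^ 2 * Complex.I_sq) hU
      exact ⟨z, hz, hzi, θ, hθ.trans (hEFsum z)⟩
    · obtain ⟨z, hz, hzi, θ, hθ⟩ := exists_nonreal_dispersion_of_factors (E := F) hEa hp
        (hEF.mono fun z h => (mul_comm _ _).trans h)
        (hnorm.mono fun t h => h.1) hpR (by
          rw [h]; simp only [hψ]
          linear_combination -deriv E x * h1
            + deriv E x * F x * E x * Complex.I_sq) hU
      exact ⟨z, hz, hzi, θ, hθ.trans ((add_comm _ _).trans (hEFsum z))⟩

end ComplexAnalysis


/-! ### Simple and degenerate band edges -/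

section BandEdge

open Filter

theorem im_deriv_eq_zero_of_real {g : ℂ → ℂ} (hg : Differentiable ℂ g)
    (hR : ∀ t : ℝ, (g t).im = 0) (x : ℝ) : (deriv g x).im = 0 := by
  have h1 := Complex.imCLM.hasFDerivAt.comp_hasDerivAt x (hg x).hasDerivAt.comp_ofReal
  have h2 : (Complex.imCLM ∘ fun t : ℝ => g t) = fun _ => 0 := funext fun t => hR t
  rw [h2] at h1
  exact h1.unique (hasDerivAt_const x 0)

variable {g : ℂ → ℂ} {k b : ℝ}

/-- A first passage of `k² (4 - g²) - g'²` through zero inside a band. -/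
theorem exists_nonreal_dispersion_of_simple_edge (hg : Differentiable ℂ g)
    (hR : ∀ t : ℝ, (g t).im = 0) (hne : ∀ x : ℝ, ¬∀ᶠ z in 𝓝 (x : ℂ), 4 - g z ^ 2 = 0)
    (hb : 0 < b) (hband : ∀ t : ℝ, 0 < t → t < b → (g t).re ^ 2 ≤ 4) (hedge : (g b).re ^ 2 = 4)
    (hsimple : deriv g b ≠ 0)
    (h0 : ∀ᶠ t : ℝ in 𝓝[>] 0, 0 < k ^ 2 * (4 - (g t).re ^ 2) - (deriv g t).re ^ 2) :
    ∃ x : ℝ, x ≠ 0 ∧ ∀ U ∈ 𝓝 (x : ℂ), ∃ z ∈ U, z.im ≠ 0 ∧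
      ∃ θ : ℝ, 2 * Complex.cos (k * z - θ) = g z := by
  have hR' := im_deriv_eq_zero_of_real hg hR
  have hgc : Continuous fun t : ℝ => (g t).re :=
    Complex.continuous_re.comp (hg.continuous.comp Complex.continuous_ofReal)
  have hgc' : Continuous fun t : ℝ => (deriv g t).re :=
    Complex.continuous_re.comp (((hg.contDiff (n := 1)).continuous_deriv le_rfl).comp
      Complex.continuous_ofReal)
  set G : ℝ → ℝ := fun t => k ^ 2 * (4 - (g t).re ^ 2) - (deriv g t).re ^ 2 with hG
  have hGc : Continuous G := by fun_prop
  have hGb : G b < 0 := by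
    have h1 : (deriv g b).re ≠ 0 := fun h => hsimple (Complex.ext h (hR' b))
    have : 0 < (deriv g b).re ^ 2 := by positivity
    simp only [hG, hedge]; linarith
  set S : Set ℝ := {t | 0 < t ∧ t < b ∧ G t < 0} with hS
  have hSne : S.Nonempty := by
    obtain ⟨t, h1, h2⟩ := (((hGc.continuousAt.eventually_lt_const hGb).filter_mono
      (nhdsWithin_le_nhds (s := Set.Iio b))).and (Ioo_mem_nhdsLT hb)).exists
    exact ⟨t, h2.1, h2.2, h1⟩
  have hSb : BddBelow S := ⟨0, fun t ht => ht.1.le⟩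
  -- `G x = 0` alone would not suffice: at a closed gap inside the band `4 - g²` and `g'` both
  -- vanish. What matters is that `G ≥ 0` to the left of `x`, while `G < 0` at points arbitrarily
  -- close on the right. These bound the limit `L` of `g'² / (4 - g²)` by `k²` from above and from
  -- below.
  set x := sInf S with hx
  obtain ⟨ε, hε, hpos⟩ := mem_nhdsGT_iff_exists_Ioo_subset.1 h0
  have hx0 : 0 < x := by
    refine lt_of_lt_of_le hε (le_csInf hSne fun t ht => ?_)
    by_contra! hlt
    exact absurd (hpos ⟨ht.1, hlt⟩ : 0 < G t) (not_lt.2 ht.2.2.le)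
  have hxb : x < b := by
    obtain ⟨t, ht⟩ := hSne
    exact (csInf_le hSb ht).trans_lt ht.2.1
  have hleft : ∀ t, 0 < t → t < x → 0 ≤ G t := fun t h1 h2 => by
    by_contra! h3
    exact absurd (csInf_le hSb ⟨h1, h2.trans hxb, h3⟩) (not_le.2 h2)
  have hGx : 0 ≤ G x := by
    by_contra! h
    obtain ⟨t, h1, h2⟩ := (((hGc.continuousAt.eventually_lt_const h).filter_mono
      (nhdsWithin_le_nhds (s := Set.Iio x))).and (Ioo_mem_nhdsLT hx0)).exists
    exact absurd (hleft t h2.1 h2.2) (not_le.2 h1)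
  have hfreq : ∃ᶠ t in 𝓝[>] x, G t < 0 := by
    rw [Filter.frequently_iff]
    intro W hW
    obtain ⟨δ, hδ, hsub⟩ := mem_nhdsGT_iff_exists_Ioo_subset.1 hW
    obtain ⟨t, ht, htδ⟩ := exists_lt_of_csInf_lt hSne hδ
    have : x < t := lt_of_le_of_ne (csInf_le hSb ht) fun h => by
      rw [← h] at ht; exact absurd hGx (not_le.2 ht.2.2)
    exact ⟨t, hsub ⟨this, htδ⟩, ht.2.2⟩
  have hnear : ∀ᶠ t : ℝ in 𝓝 x, (g t).re ^ 2 ≤ 4 := by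
    filter_upwards [Ioo_mem_nhds hx0 hxb] with t ht using hband t ht.1 ht.2
  obtain ⟨L, hL, hconc⟩ := exists_nonreal_dispersion (g := g) (p := fun z => k * z) (x := x)
    (hg.analyticAt _) (by fun_prop) (hnear.mono fun t h => ⟨hR t, h⟩)
    (Eventually.of_forall fun t => by simp) (hne x)
  have hcoe : Tendsto (fun t : ℝ => (t : ℂ)) (𝓝[≠] x) (𝓝[≠] (x : ℂ)) :=
    tendsto_nhdsWithin_iff.2 ⟨(Complex.continuous_ofReal.tendsto x).mono_left nhdsWithin_le_nhds,
      eventually_mem_nhdsWithin.mono fun t ht => by simpa using ht⟩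
  have hreal : ∀ t : ℝ, deriv g t ^ 2 / (4 - g t ^ 2)
      = (((deriv g t).re ^ 2 / (4 - (g t).re ^ 2) : ℝ) : ℂ) := fun t => by
    have h1 : g t = ((g t).re : ℂ) := Complex.ext rfl (hR t)
    have h2 : deriv g t = ((deriv g t).re : ℂ) := Complex.ext rfl (hR' t)
    push_cast
    rw [← h1, ← h2]
  have hlim := hL.comp hcoe
  have hlimre : Tendsto (fun t : ℝ => (deriv g t).re ^ 2 / (4 - (g t).re ^ 2)) (𝓝[≠] x)
      (𝓝 L.re) := by
    refine ((Complex.continuous_re.tendsto _).comp hlim).congr fun t => ?_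
    simp only [Function.comp_apply]
    rw [hreal, Complex.ofReal_re]
  have him : L.im = 0 := by
    refine tendsto_nhds_unique ((Complex.continuous_im.tendsto _).comp hlim)
      (tendsto_const_nhds.congr fun t => ?_)
    simp only [Function.comp_apply]
    rw [hreal, Complex.ofReal_im]
  have hne' : ∀ᶠ t : ℝ in 𝓝[≠] x, 4 - (g t).re ^ 2 ≠ 0 := by
    have hh : AnalyticAt ℂ (fun z => 4 - g z ^ 2) x := by
      have := hg.analyticAt x
      fun_prop
    filter_upwards [hcoe.eventually
      (hh.eventually_eq_zero_or_eventually_ne_zero.resolve_left (hne x))] with t ht h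
    refine ht ?_
    have h1 : g t = ((g t).re : ℂ) := Complex.ext rfl (hR t)
    rw [h1]
    exact_mod_cast h
  have hle : L.re ≤ k ^ 2 := by
    have hmono : 𝓝[<] x ≤ 𝓝[≠] x := nhdsWithin_mono x fun t (ht : t < x) => ht.ne
    refine le_of_tendsto (hlimre.mono_left hmono) ?_
    filter_upwards [Ioo_mem_nhdsLT hx0] with t ht
    have h1 := hband t ht.1 (ht.2.trans hxb)
    have h2 := hleft t ht.1 ht.2
    refine div_le_of_le_mul₀ (by linarith) (sq_nonneg k) ?_
    simp only [hG] at h2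
    linarith
  have hge : k ^ 2 ≤ L.re := by
    by_contra! hlt
    have h1 := (hlimre.mono_left (nhdsWithin_mono x fun t (ht : x < t) => ht.ne')).eventually_lt_const
      hlt
    obtain ⟨t, h2, h3, h4, h5⟩ := (hfreq.and_eventually (h1.and
      ((hnear.filter_mono nhdsWithin_le_nhds).and (hne'.filter_mono
        (nhdsWithin_mono x fun t (ht : x < t) => ht.ne'))))).exists
    have h6 : 0 < 4 - (g t).re ^ 2 := lt_of_le_of_ne (by linarith) (Ne.symm h5)
    rw [div_lt_iff₀ h6] at h3
    simp only [hG] at h2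
    linarith
  refine ⟨x, hx0.ne', hconc ?_⟩
  have hd : deriv (fun z : ℂ => (k : ℂ) * z) x = k := by simp
  rw [hd]
  refine Complex.ext ?_ ?_
  · rw [← Complex.ofReal_pow, Complex.ofReal_re]; linarith
  · rw [← Complex.ofReal_pow, Complex.ofReal_im, him]

/-- A degenerate band edge is itself a point near which the dispersion relation has nonreal
solutions; the square root `ζ ↦ b - ζ²` uniformizes the branch point. -/
theorem exists_nonreal_dispersion_of_degenerate_edge (hg : Differentiable ℂ g)
    (hR : ∀ t : ℝ, (g t).im = 0) (hne : ¬∀ᶠ z in 𝓝 (b : ℂ), 4 - g z ^ 2 = 0)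
    (hb : 0 < b) (hband : ∀ t : ℝ, 0 < t → t < b → (g t).re ^ 2 ≤ 4) (hedge : (g b).re ^ 2 = 4)
    (hgap : ∀ᶠ t : ℝ in 𝓝[>] b, 4 < (g t).re ^ 2) (hdeg : deriv g b = 0) (k : ℝ) {U : Set ℂ}
    (hU : U ∈ 𝓝 (b : ℂ)) :
    ∃ z ∈ U, z.im ≠ 0 ∧ ∃ θ : ℝ, 2 * Complex.cos (k * z - θ) = g z := by
  have hσ : Continuous fun z : ℂ => (b : ℂ) - z ^ 2 := by fun_prop
  have hσ0 : Tendsto (fun z : ℂ => (b : ℂ) - z ^ 2) (𝓝 0) (𝓝 (b : ℂ)) := by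
    simpa using hσ.tendsto 0
  have hσne : Tendsto (fun z : ℂ => (b : ℂ) - z ^ 2) (𝓝[≠] 0) (𝓝[≠] (b : ℂ)) :=
    tendsto_nhdsWithin_iff.2 ⟨hσ0.mono_left nhdsWithin_le_nhds,
      eventually_mem_nhdsWithin.mono fun z hz => by
        have : z ≠ 0 := hz
        simpa using this⟩
  have hg2 : g b ^ 2 = 4 := by
    have h1 : g b = ((g b).re : ℂ) := Complex.ext rfl (hR b)
    rw [h1]
    exact_mod_cast congrArg Complex.ofReal hedge
  have hgb0 : g b ≠ 0 := fun h => by simp [h] at hg2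
  have hgd : ∀ z : ℂ, HasDerivAt (fun z => g (b - z ^ 2)) (deriv g (b - z ^ 2) * (-(2 * z))) z :=
    fun z => (hg _).hasDerivAt.comp z
      ((((hasDerivAt_id z).pow 2).const_sub (b : ℂ)).congr_deriv (by simp))
  have hgσ : Differentiable ℂ fun z => g (b - z ^ 2) := fun z => (hgd z).differentiableAt
  -- The map `t ↦ b - t²` folds both sides of 0 into the band, so the interior result applies at `ζ
  -- = 0`.
  have hnear : ∀ᶠ t : ℝ in 𝓝 0, (g ((b : ℂ) - (t : ℂ) ^ 2)).im = 0 ∧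
      (g ((b : ℂ) - (t : ℂ) ^ 2)).re ^ 2 ≤ 4 := by
    have hc : Continuous fun t : ℝ => b - t ^ 2 := by fun_prop
    have : ∀ᶠ t : ℝ in 𝓝 0, 0 < b - t ^ 2 :=
      (hc.tendsto 0).eventually_const_lt (by simpa using hb)
    filter_upwards [this] with t ht
    have e : (b : ℂ) - (t : ℂ) ^ 2 = ((b - t ^ 2 : ℝ) : ℂ) := by push_cast; rfl
    rw [e]
    refine ⟨hR _, ?_⟩
    rcases eq_or_ne t 0 with rfl | h
    · simp [hedge]
    · have : 0 < t ^ 2 := by positivity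
      exact hband _ ht (by linarith)
  have hh : AnalyticAt ℂ (fun z => 4 - g z ^ 2) b := by
    have := hg.analyticAt b
    fun_prop
  have hne' := hh.eventually_eq_zero_or_eventually_ne_zero.resolve_left hne
  obtain ⟨L, hL, hconc⟩ := exists_nonreal_dispersion (g := fun z => g (b - z ^ 2))
    (p := fun z => k * (b - z ^ 2)) (x := 0)
    (hgσ.analyticAt _) (by fun_prop) hnear
    (Eventually.of_forall fun t => by
      rw [← Complex.ofReal_pow, ← Complex.ofReal_sub, ← Complex.ofReal_mul, Complex.ofReal_im])
    (fun h => by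
      obtain ⟨z, h1, h2⟩ := ((h.filter_mono nhdsWithin_le_nhds).and
        (hσne.eventually (by simpa using hne'))).exists
      exact h2 h1)
  rw [Complex.ofReal_zero] at hL hconc
  obtain ⟨n, u, hu, hu0, hfac⟩ := hh.exists_eventuallyEq_pow_smul_nonzero_iff.2 hne
  simp only [smul_eq_mul] at hfac
  -- With `w = b - ζ²`, the squared phase velocity in `ζ` is `-4 (w - b) g'(w)² / (4 - g(w)²)`.
  -- Inserting the logarithmic derivative of `4 - g² = (w - b) ^ n * u` turns it into `Q w`, which
  -- is continuous at `b` and vanishes there because `g' b = 0`. The velocity of `k (b - ζ²)` at `ζ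
  -- = 0` is also 0, so the two agree.
  set Q : ℂ → ℂ := fun w =>
    2 * (n + (w - b) * deriv u w / u w) * (deriv g w / g w) with hQ
  have hQc : ContinuousAt Q b := by
    have h1 := hu.deriv.continuousAt
    have h2 := hu.continuousAt
    have h3 := (hg.analyticAt b).deriv.continuousAt
    have h4 := hg.continuous.continuousAt (x := (b : ℂ))
    have h5 : ContinuousAt (fun w : ℂ => (w - b) * deriv u w / u w) b :=
      ((continuousAt_id.sub continuousAt_const).mul h1).div h2 hu0
    exact (continuousAt_const.mul (continuousAt_const.add h5)).mul (h3.div h4 hgb0)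
  have hQb : Q b = 0 := by simp [hQ, hdeg]
  have hQeq : ∀ᶠ w in 𝓝[≠] (b : ℂ), -4 * (w - b) * deriv g w ^ 2 / (4 - g w ^ 2) = Q w := by
    filter_upwards [hne', hfac.eventually_nhds.filter_mono nhdsWithin_le_nhds,
      hu.eventually_analyticAt.filter_mono nhdsWithin_le_nhds,
      (hu.continuousAt.eventually_ne hu0).filter_mono nhdsWithin_le_nhds,
      (hg.continuous.continuousAt.eventually_ne hgb0).filter_mono nhdsWithin_le_nhds]
      with w h1 h2 h3 h4 h5
    have d1 : HasDerivAt (fun z => 4 - g z ^ 2) (-(2 * g w * deriv g w)) w :=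
      (((hg w).hasDerivAt.pow 2).const_sub 4).congr_deriv (by simp)
    have d2 := (((hasDerivAt_id w).sub_const (b : ℂ)).pow n).mul h3.differentiableAt.hasDerivAt
    have d3 := d1.unique (d2.congr_of_eventuallyEq h2)
    have h6 := h2.self_of_nhds
    have d4 : (w - b) * -(2 * g w * deriv g w)
        = (n * u w + (w - b) * deriv u w) * (w - b) ^ n := by
      rw [d3]
      rcases n with _ | n
      · simp
      · simp [pow_succ]; ring
    have h7 : (w - (b : ℂ)) ^ n ≠ 0 := fun h => h1 (by rw [h6, h, zero_mul])
    rw [div_eq_iff h1, h6]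
    simp only [hQ]
    field_simp
    linear_combination 2 * deriv g w * d4
  have hlim0 : Tendsto (fun z => deriv (fun z => g (b - z ^ 2)) z ^ 2 / (4 - g (b - z ^ 2) ^ 2))
      (𝓝[≠] 0) (𝓝 0) := by
    have h1 : Tendsto (fun z : ℂ => Q (b - z ^ 2)) (𝓝[≠] 0) (𝓝 0) := by
      have := (hQc.tendsto.comp hσ0).mono_left (nhdsWithin_le_nhds (s := {0}ᶜ))
      rwa [hQb] at this
    refine h1.congr' ?_
    filter_upwards [hσne.eventually hQeq] with z hz
    rw [← hz, (hgd z).deriv]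
    congr 1; ring
  have hL0 : L = 0 := tendsto_nhds_unique hL hlim0
  have hd : deriv (fun z : ℂ => (k : ℂ) * (b - z ^ 2)) 0 = 0 := by
    refine ((((hasDerivAt_id (0 : ℂ)).pow 2).const_sub (b : ℂ)).const_mul (k : ℂ)).deriv.trans ?_
    simp
  obtain ⟨δ, hδ, hδgap⟩ := mem_nhdsGT_iff_exists_Ioo_subset.1 hgap
  have hball : Metric.ball (b : ℂ) (δ - b) ∈ 𝓝 (b : ℂ) := Metric.ball_mem_nhds _ (sub_pos.2 hδ)
  obtain ⟨z, ⟨hzU, hzball⟩, hzim, θ, hθ⟩ := hconc (by rw [hd, hL0]; simp) _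
    (hσ0 (Filter.inter_mem hU hball))
  -- If `b - ζ²` were real with `ζ` nonreal, `ζ` would be purely imaginary and `b - ζ² > b` would
  -- lie in the gap, where `g² > 4` contradicts `g = 2 cos` of a real number.
  refine ⟨b - z ^ 2, hzU, fun him => ?_, θ, hθ⟩
  have hz2 : z.re * z.im = 0 := by
    rw [Complex.sub_im, Complex.ofReal_im, pow_two, Complex.mul_im] at him
    linarith
  have hzre : z.re = 0 := (mul_eq_zero.1 hz2).resolve_right hzim
  have hzr : (b : ℂ) - z ^ 2 = ((b + z.im ^ 2 : ℝ) : ℂ) := by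
    refine Complex.ext ?_ (by rw [him, Complex.ofReal_im])
    rw [Complex.sub_re, Complex.ofReal_re, pow_two, Complex.mul_re, hzre, Complex.ofReal_re]
    ring
  change (b : ℂ) - z ^ 2 ∈ Metric.ball (b : ℂ) (δ - b) at hzball
  rw [hzr, Metric.mem_ball, dist_eq_norm,
    ← Complex.ofReal_sub, Complex.norm_real, Real.norm_eq_abs] at hzball
  have him2 : 0 < z.im ^ 2 := by positivity
  have h1 : (4 : ℝ) < (g ((b + z.im ^ 2 : ℝ) : ℂ)).re ^ 2 :=
    hδgap ⟨by linarith, by have := (abs_lt.1 hzball).2; linarith⟩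
  rw [hzr, ← Complex.ofReal_mul, ← Complex.ofReal_sub, ← Complex.ofReal_cos] at hθ
  rw [← hθ, ← Complex.ofReal_ofNat, ← Complex.ofReal_mul, Complex.ofReal_re] at h1
  nlinarith [Real.cos_sq_le_one (k * (b + z.im ^ 2) - θ)]

end BandEdge

/-! ### Existence of the bifurcation point and the instability -/

open Filter in
/-- If `D` is a discriminant with `0 < D'(0) < k²` and with a gap on the negative half-line, then
the dispersion relation `2 cos (k z - θ) = D (-z²)` with real `θ` has nonreal solutions arbitrarily
close to some nonzero real point. -/
theorem exists_nonreal_dispersion_of_gap {D : ℂ → ℂ} (hD : Differentiable ℂ D)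
    (hR : ∀ t : ℝ, (D t).im = 0) (hD0 : D 0 = 2) {k : ℝ} (ha : 0 < (deriv D 0).re)
    (hak : (deriv D 0).re < k ^ 2) {ν : ℝ} (hν : ν < 0) (hgap : 4 < (D ν).re ^ 2) :
    ∃ x : ℝ, x ≠ 0 ∧ ∀ U ∈ 𝓝 (x : ℂ), ∃ z ∈ U, z.im ≠ 0 ∧
      ∃ θ : ℝ, 2 * Complex.cos (k * z - θ) = D (-z ^ 2) := by
  set g : ℂ → ℂ := fun z => D (-z ^ 2) with hg_def
  have hgd : ∀ z, HasDerivAt g (deriv D (-z ^ 2) * (-(2 * z))) z := fun z =>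
    (hD _).hasDerivAt.comp z ((((hasDerivAt_id z).pow 2).neg).congr_deriv (by simp))
  have hg : Differentiable ℂ g := fun z => (hgd z).differentiableAt
  have hgR : ∀ t : ℝ, (g t).im = 0 := fun t => by
    have e : -(t : ℂ) ^ 2 = ((-t ^ 2 : ℝ) : ℂ) := by push_cast; rfl
    simp only [hg_def]
    rw [e]
    exact hR _
  have hsq : (Real.sqrt (-ν)) ^ 2 = -ν := Real.sq_sqrt (by linarith)
  have hgν : 4 < (g (Real.sqrt (-ν))).re ^ 2 := by
    have e : -(Real.sqrt (-ν) : ℂ) ^ 2 = (ν : ℂ) := by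
      rw [← Complex.ofReal_pow, hsq]; simp
    simp only [hg_def]
    rwa [e]
  have hne : ∀ x : ℝ, ¬∀ᶠ z in 𝓝 (x : ℂ), 4 - g z ^ 2 = 0 := by
    intro x hx
    have h1 : (fun z => 4 - g z ^ 2) = fun _ => 0 :=
      AnalyticOnNhd.eq_of_eventuallyEq (z₀ := (x : ℂ))
        (fun z _ => analyticAt_const.sub ((hg.analyticAt z).pow 2)) (fun z _ => analyticAt_const) hx
    have h2 := congrFun h1 (Real.sqrt (-ν))
    have h3 : g (Real.sqrt (-ν)) = ((g (Real.sqrt (-ν))).re : ℂ) := Complex.ext rfl (hgR _)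
    rw [h3] at h2
    have h4 : 4 - (g (Real.sqrt (-ν))).re ^ 2 = 0 := by exact_mod_cast h2
    linarith
  have hgc : Continuous fun t : ℝ => (g t).re :=
    Complex.continuous_re.comp (hg.continuous.comp Complex.continuous_ofReal)
  -- the behaviour at the origin
  have hS : ∀ w, D w = 2 + w * dslope D 0 w := fun w => by
    have := sub_smul_dslope D 0 w
    rw [sub_zero, smul_eq_mul, hD0] at this
    rw [this]; ring
  have hSc : Continuous (dslope D 0) := by
    rw [← continuousOn_univ, continuousOn_dslope Filter.univ_mem]
    exact ⟨hD.continuous.continuousOn, hD 0⟩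
  have hDc : Continuous (deriv D) := (hD.contDiff (n := 1)).continuous_deriv le_rfl
  -- Both `4 - g²` and `g'²` carry a factor `t²`. Dividing it out leaves continuous functions whose
  -- values at 0 are `4a` and `4a²`, with `a = D'(0)`; thus `G / t²` tends to `4a (k² - a) > 0`.
  have hreS : ∀ t : ℝ, 4 - (g t).re ^ 2
      = t ^ 2 * (dslope D 0 (-(t : ℂ) ^ 2) * (2 + g t)).re := by
    intro t
    have h1 : g t = ((g t).re : ℂ) := Complex.ext rfl (hgR t)
    have h2 : ((4 - (g t).re ^ 2 : ℝ) : ℂ)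
        = ((t ^ 2 : ℝ) : ℂ) * (dslope D 0 (-(t : ℂ) ^ 2) * (2 + g t)) := by
      push_cast
      rw [← h1]
      have := hS (-(t : ℂ) ^ 2)
      change g t = _ at this
      linear_combination (-2 - g t) * this
    rw [← Complex.ofReal_re (4 - (g t).re ^ 2), h2, Complex.re_ofReal_mul]
  have hgre' : ∀ t : ℝ, (deriv g t).re ^ 2 = t ^ 2 * (4 * (deriv D (-(t : ℂ) ^ 2)).re ^ 2) := by
    intro t
    rw [(hgd t).deriv, show deriv D (-(t : ℂ) ^ 2) * (-(2 * (t : ℂ)))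
      = ((-(2 * t) : ℝ) : ℂ) * deriv D (-(t : ℂ) ^ 2) by push_cast; ring, Complex.re_ofReal_mul]
    ring
  have hg0 : g 0 = 2 := by simp [hg_def, hD0]
  have hH0 : ∀ᶠ t : ℝ in 𝓝[>] 0, 0 < 4 - (g t).re ^ 2 := by
    have hc : Continuous fun t : ℝ => (dslope D 0 (-(t : ℂ) ^ 2) * (2 + g t)).re :=
      Complex.continuous_re.comp ((hSc.comp (by fun_prop)).mul
        (continuous_const.add (hg.continuous.comp Complex.continuous_ofReal)))
    have hev : ∀ᶠ t : ℝ in 𝓝 0, 0 < (dslope D 0 (-(t : ℂ) ^ 2) * (2 + g t)).re := by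
      refine (hc.tendsto 0).eventually_const_lt ?_
      have e : dslope D 0 (-((0 : ℝ) : ℂ) ^ 2) * (2 + g ((0 : ℝ) : ℂ))
          = deriv D 0 * ((4 : ℝ) : ℂ) := by
        rw [Complex.ofReal_zero, hg0]; simp; norm_num
      rw [e, Complex.re_mul_ofReal]
      positivity
    filter_upwards [hev.filter_mono nhdsWithin_le_nhds, self_mem_nhdsWithin] with t h1 h2
    rw [hreS]
    have : (0 : ℝ) < t := h2
    positivity
  have hG0 : ∀ᶠ t : ℝ in 𝓝[>] 0, 0 < k ^ 2 * (4 - (g t).re ^ 2) - (deriv g t).re ^ 2 := by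
    have hc : Continuous fun t : ℝ => k ^ 2 * (dslope D 0 (-(t : ℂ) ^ 2) * (2 + g t)).re
        - 4 * (deriv D (-(t : ℂ) ^ 2)).re ^ 2 :=
      (continuous_const.mul (Complex.continuous_re.comp ((hSc.comp (by fun_prop)).mul
        (continuous_const.add (hg.continuous.comp Complex.continuous_ofReal))))).sub
        (continuous_const.mul ((Complex.continuous_re.comp (hDc.comp (by fun_prop))).pow 2))
    have hev : ∀ᶠ t : ℝ in 𝓝 0, 0 < k ^ 2 * (dslope D 0 (-(t : ℂ) ^ 2) * (2 + g t)).re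
        - 4 * (deriv D (-(t : ℂ) ^ 2)).re ^ 2 := by
      refine (hc.tendsto 0).eventually_const_lt ?_
      have e : dslope D 0 (-((0 : ℝ) : ℂ) ^ 2) * (2 + g ((0 : ℝ) : ℂ))
          = deriv D 0 * ((4 : ℝ) : ℂ) := by
        rw [Complex.ofReal_zero, hg0]; simp; norm_num
      have e2 : deriv D (-((0 : ℝ) : ℂ) ^ 2) = deriv D 0 := by simp
      rw [e, e2, Complex.re_mul_ofReal]
      nlinarith [mul_pos ha (sub_pos.2 hak)]
    filter_upwards [hev.filter_mono nhdsWithin_le_nhds, self_mem_nhdsWithin] with t h1 h2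
    have : (0 : ℝ) < t := h2
    have h3 := mul_pos (pow_pos this 2) h1
    rw [hreS, hgre']
    linarith
  -- the first band edge
  set S : Set ℝ := {t | 0 < t ∧ 4 < (g t).re ^ 2} with hSdef
  have hSne : S.Nonempty := ⟨_, Real.sqrt_pos.2 (by linarith), hgν⟩
  have hSb : BddBelow S := ⟨0, fun t ht => ht.1.le⟩
  set b := sInf S with hb_def
  obtain ⟨ε, hε, hpos⟩ := mem_nhdsGT_iff_exists_Ioo_subset.1 hH0
  have hb : 0 < b := by
    refine lt_of_lt_of_le hε (le_csInf hSne fun t ht => ?_)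
    by_contra! hlt
    have h1 : 0 < 4 - (g t).re ^ 2 := hpos ⟨ht.1, hlt⟩
    linarith [ht.2]
  have hband : ∀ t : ℝ, 0 < t → t < b → (g t).re ^ 2 ≤ 4 := fun t h1 h2 => by
    by_contra! h3
    exact absurd (csInf_le hSb ⟨h1, h3⟩) (not_le.2 h2)
  have hle : (g b).re ^ 2 ≤ 4 := by
    by_contra! h
    obtain ⟨t, h1, h2⟩ := (((hgc.pow 2).continuousAt.eventually_const_lt h).filter_mono
      (nhdsWithin_le_nhds (s := Set.Iio b)) |>.and (Ioo_mem_nhdsLT hb)).exists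
    exact absurd (hband t h2.1 h2.2) (not_le.2 h1)
  have hexists : ∀ δ, b < δ → ∃ t, b < t ∧ t < δ ∧ 4 < (g t).re ^ 2 := fun δ hδ => by
    obtain ⟨t, ht, htδ⟩ := exists_lt_of_csInf_lt hSne hδ
    refine ⟨t, lt_of_le_of_ne (csInf_le hSb ht) fun h => ?_, htδ, ht.2⟩
    have := ht.2
    rw [← h] at this
    exact absurd hle (not_le.2 this)
  have hedge : (g b).re ^ 2 = 4 := by
    refine le_antisymm hle (not_lt.1 fun h => ?_)
    obtain ⟨δ, hδ, hsub⟩ := mem_nhdsGT_iff_exists_Ioo_subset.1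
      (((hgc.pow 2).continuousAt.eventually_lt_const h).filter_mono
        (nhdsWithin_le_nhds (s := Set.Ioi b)))
    obtain ⟨t, h1, h2, h3⟩ := hexists δ hδ
    have h4 : (g t).re ^ 2 < 4 := hsub ⟨h1, h2⟩
    linarith
  by_cases hsimple : deriv g b = 0
  swap
  · exact exists_nonreal_dispersion_of_simple_edge hg hgR hne hb hband hedge hsimple hG0
  refine ⟨b, hb.ne', fun U hU => exists_nonreal_dispersion_of_degenerate_edge hg hgR (hne b) hb
    hband hedge ?_ hsimple k hU⟩
  have hh : AnalyticAt ℂ (fun z => 4 - g z ^ 2) b := by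
    have := hg.analyticAt b
    fun_prop
  have hcoe : Tendsto (fun t : ℝ => (t : ℂ)) (𝓝[>] b) (𝓝[≠] (b : ℂ)) :=
    tendsto_nhdsWithin_iff.2 ⟨(Complex.continuous_ofReal.tendsto b).mono_left nhdsWithin_le_nhds,
      eventually_mem_nhdsWithin.mono fun t ht => by simpa using (ne_of_gt ht : t ≠ b)⟩
  -- Zeros of `4 - g²` are isolated, so `g² - 4` has one sign just to the right of `b`. It is
  -- positive because `b` is a limit of gap points from the right.
  have hnz : ∀ᶠ t : ℝ in 𝓝[>] b, (g t).re ^ 2 ≠ 4 := by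
    filter_upwards [hcoe.eventually
      (hh.eventually_eq_zero_or_eventually_ne_zero.resolve_left (hne b))] with t ht h
    refine ht ?_
    have h1 : g t = ((g t).re : ℂ) := Complex.ext rfl (hgR t)
    rw [h1, ← Complex.ofReal_pow, h]
    simp
  obtain ⟨δ, hδ, hsub⟩ := mem_nhdsGT_iff_exists_Ioo_subset.1 hnz
  obtain ⟨s, hs1, hs2, hs3⟩ := hexists δ hδ
  filter_upwards [Ioo_mem_nhdsGT hδ] with t ht
  by_contra! hlt
  obtain ⟨r, hr, hr4⟩ := intermediate_value_uIcc (a := t) (b := s) (hgc.pow 2).continuousOn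
    (show (4 : ℝ) ∈ _ from Set.mem_uIcc.2 (Or.inl ⟨hlt, hs3.le⟩))
  exact hsub (Set.OrdConnected.uIcc_subset Set.ordConnected_Ioo ht ⟨hs1, hs2⟩ hr) hr4

end KleinGordon

theorem corollary3 (V : ℝ → ℝ) (hV : ContDiff ℝ 2 V) (c T : ℝ) (f : ℝ → ℝ)
    (hf : KleinGordon.IsPeriodicTravelingWave V c T f)
    (hgen : deriv (KleinGordon.hillDiscriminant (KleinGordon.hillPotential V c f) T) 0
      ≠ (c : ℂ) ^ 2 * (T : ℂ) ^ 2)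
    (hindex : KleinGordon.modulationalIndex V c T f * KleinGordon.parityIndex V c T f = 1)
    (hgap : KleinGordon.HasNegativeGap (KleinGordon.hillPotential V c f) T)
    (hc : c ^ 2 - 1 > 0) :
    ∃ lam : ℂ, KleinGordon.HasDynamicalHHInstabilityAt V c f lam := by
  have hP := KleinGordon.continuous_hillPotential (c := c) hV hf.contDiff.continuous
  obtain ⟨K, hK⟩ := hf.exists_hillPotential_bound hV hc.ne'
  obtain ⟨ha, hak⟩ := KleinGordon.deriv_hillDiscriminant_mem hV hc hf hindex
  obtain ⟨ν, hν, hνgap⟩ := hgap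
  obtain ⟨x, hx, hU⟩ := KleinGordon.exists_nonreal_dispersion_of_gap
    (KleinGordon.differentiable_hillDiscriminant hP hK hf.period_pos.le)
    (KleinGordon.hillDiscriminant_ofReal_im hP hK)
    (KleinGordon.hillDiscriminant_eq_two_of_periodic hP hK (hf.isHillSol hV hc.ne')
      hf.deriv_ne_zero fun t => by simp [hf.fundamental_period.1.2 t])
    ha hak hν (KleinGordon.sq_re_hillDiscriminant_gt hP hK hνgap)
  have hcC : (c : ℂ) ^ 2 - 1 = ((c ^ 2 - 1 : ℝ) : ℂ) := by push_cast; rfl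
  -- `z ↦ (c² - 1) i z` carries real points to imaginary `λ` and nonreal points off the imaginary
  -- axis.
  refine ⟨((c : ℂ) ^ 2 - 1) * (Complex.I * x), ?_, ?_, fun W hW => ?_⟩
  · refine mul_ne_zero (by rw [hcC]; exact_mod_cast hc.ne') (mul_ne_zero Complex.I_ne_zero ?_)
    exact_mod_cast hx
  · rw [hcC, Complex.re_ofReal_mul]; simp
  · have hcont : Continuous fun z : ℂ => ((c : ℂ) ^ 2 - 1) * (Complex.I * z) := by fun_prop
    obtain ⟨z, hz, hzim, θ, hθ⟩ := hU _ (hcont.continuousAt hW)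
    refine ⟨_, ⟨KleinGordon.mem_floquetSpectrum hV hc.ne' hf hθ, hz⟩, fun hre => ?_⟩
    change (((c : ℂ) ^ 2 - 1) * (Complex.I * z)).re = 0 at hre
    rw [hcC, Complex.re_ofReal_mul, Complex.I_mul_re] at hre
    exact hzim (neg_eq_zero.1 ((mul_eq_zero.1 hre).resolve_left hc.ne'))
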